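/- Let $d\ge 1$ be an integer, let $I\subseteq\mathbb R$ be a non-empty bounded open interval, and let $1\le q<\infty$. Let $\mathcal A_d(\mathbb C)$ be the set of unordered tuples $[z]=[z_1,\dots,z_d]$ of complex numbers, with the metric $\mathbf d([z],[w])=\min_{\sigma\in S_d}\frac1{\sqrt d}\big(\sum_i|z_i-w_{\sigma(i)}|^2\big)^{1/2}$. Let $W^{1,q}(I,\mathcal A_d(\mathbb C))$ be the set of measurable $f:I\to\mathcal A_d(\mathbb C)$ for which there is $0\le\varphi\in L^q(I)$ such that, for every $T\in\mathcal A_d(\mathbb C)$, one has $\mathbf d(f,T)\in W^{1,q}(I)$ and $|\mathbf d(f,T)'|\le\varphi$ almost everywhere; functions that coincide almost everywhere are identified, and $f$ always denotes the continuous representative. A curve $f$ is differentiable at $x_0\in I$, where $f(x_0)=[z_1,\dots,z_d]$, if there are $L_1,\dots,L_d\in\mathbb C$ with $L_i=L_j$ whenever $z_i=z_j$ and $\mathbf d\big(f(x),[z_i+L_i(x-x_0)]_i\big)=o(|x-x_0|)$ as $x\to x_0$. For $f,g\in W^{1,q}(I,\mathcal A_d(\mathbb C))$ and $x\in I$ at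 which both are differentiable, with $f(x)=[z]$, $g(x)=[w]$ and corresponding derivatives $L$, $M$, let $\mathbf s_1(f,g)(x)$ be the maximum of $\frac1{\sqrt d}\big(\sum_i|L_i-M_{\tau(i)}|^2\big)^{1/2}$ over all $\tau\in S_d$ with $\frac1{\sqrt d}\big(\sum_i|z_i-w_{\tau(i)}|^2\big)^{1/2}=\mathbf d(f(x),g(x))$; let $\mathbf s_1(f,g)=0$ elsewhere. Set $$\mathbf d^{1,q}_I(f,g)=\|\mathbf d(f,g)\|_{L^\infty(I)}+\|\mathbf s_1(f,g)\|_{L^q(I)}.$$ Let $\theta_1,\dots,\theta_h$ be unit complex numbers for which there is $\alpha>0$ such that for all $z_1,\dots,z_{d^2}\in\mathbb C$ there is $l$ with $|\operatorname{Re}(\theta_lz_k)|\ge\alpha|z_k|$ for all $k$. The associated Almgren embedding is $\Delta=h^{-1/2}(H_1,\dots,H_h):\mathcal A_d(\mathbb C)\to\mathbb R^{dh}$, where $H_l([z])$ is the array of the numbers $\operatorname{Re}(\theta_lz_i)$, $1\le i\le d$, arranged in increasing order. Then, for every Almgren embedding $\Delta$ and all $f,f_n\in W^{1,q}(I,\mathcal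 A_d(\mathbb C))$, $$\mathbf d^{1,q}_I(f,f_n)\to0\quad\Longleftrightarrow\quad\|\Delta\circ f_n-\Delta\circ f\|_{W^{1,q}(I,\mathbb R^{dh})}\to0\qquad(n\to\infty),$$ where $\|u\|_{W^{1,q}}=\|u\|_{L^q}+\|u'\|_{L^q}$ with Euclidean norms on $\mathbb R^{dh}$. In particular, the topology on $W^{1,q}(I,\mathcal A_d(\mathbb C))$ induced by the metric $(f,g)\mapsto\|\Delta\circ f-\Delta\circ g\|_{W^{1,q}(I,\mathbb R^{dh})}$ is the same for all Almgren embeddings $\Delta$. -/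

import Mathlib

open Set Filter Topology MeasureTheory
open scoped ENNReal

noncomputable section

namespace DValued

/-! ### Unordered tuples of complex numbers -/

/-- The normalized Euclidean distance `(1/√d) (∑ |z i - w i|²)^(1/2)` of ordered tuples. -/
def tupleDist {d : ℕ} (z w : Fin d → ℂ) : ℝ :=
  (1 / √(d : ℝ)) * √(∑ i, ‖z i - w i‖ ^ 2)

/-- Two ordered tuples are equivalent if they agree up to a permutation of the entries. -/
instance permSetoid (d : ℕ) : Setoid (Fin d → ℂ) where
  r z w := ∃ σ : Equiv.Perm (Fin d), w = z ∘ σ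
  iseqv :=
    { refl := fun z => ⟨1, rfl⟩
      symm := by
        rintro z _ ⟨σ, rfl⟩
        exact ⟨σ⁻¹, by ext i; simp⟩
      trans := by
        rintro z _ _ ⟨σ, rfl⟩ ⟨τ, rfl⟩
        exact ⟨σ * τ, rfl⟩ }

/-- The set `𝒜_d(ℂ)` of unordered `d`-tuples of complex numbers. -/
def UTuple (d : ℕ) : Type := Quotient (permSetoid d)

/-- The unordered tuple `[z]` of an ordered tuple `z`. -/
def UTuple.mk {d : ℕ} (z : Fin d → ℂ) : UTuple d := Quotient.mk (permSetoid d) z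

/-- The smallest distance between `z` and a rearrangement of `w`. -/
def permDist {d : ℕ} (z w : Fin d → ℂ) : ℝ :=
  Finset.univ.inf' Finset.univ_nonempty fun σ : Equiv.Perm (Fin d) => tupleDist z (w ∘ σ)

theorem tupleDist_nonneg {d : ℕ} (z w : Fin d → ℂ) : 0 ≤ tupleDist z w := by
  unfold tupleDist; positivity

theorem tupleDist_comm {d : ℕ} (z w : Fin d → ℂ) : tupleDist z w = tupleDist w z := by
  simp only [tupleDist, norm_sub_rev]

theorem tupleDist_comp {d : ℕ} (z w : Fin d → ℂ) (σ : Equiv.Perm (Fin d)) :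
    tupleDist (z ∘ σ) (w ∘ σ) = tupleDist z w := by
  simp only [tupleDist, Function.comp_apply]
  rw [Equiv.sum_comp σ fun i => ‖z i - w i‖ ^ 2]

theorem tupleDist_triangle {d : ℕ} (z w v : Fin d → ℂ) :
    tupleDist z v ≤ tupleDist z w + tupleDist w v := by
  have h := dist_triangle (WithLp.toLp 2 z : EuclideanSpace ℂ (Fin d)) (WithLp.toLp 2 w)
    (WithLp.toLp 2 v)
  simp only [EuclideanSpace.dist_eq] at h
  simp only [dist_eq_norm] at h
  unfold tupleDist
  rw [← mul_add]
  exact mul_le_mul_of_nonneg_left h (by positivity)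

theorem eq_of_tupleDist_eq_zero {d : ℕ} {z w : Fin d → ℂ} (h : tupleDist z w = 0) : z = w := by
  ext i
  have hd : 0 < d := i.pos
  unfold tupleDist at h
  rcases mul_eq_zero.mp h with h | h
  · have : 0 < 1 / √(d : ℝ) := by positivity
    linarith
  · rw [Real.sqrt_eq_zero (by positivity),
      Finset.sum_eq_zero_iff_of_nonneg (fun _ _ => by positivity)] at h
    have := h i (Finset.mem_univ _)
    rw [sq_eq_zero_iff, norm_eq_zero, sub_eq_zero] at this
    exact this

theorem permDist_le {d : ℕ} (z w : Fin d → ℂ) (σ : Equiv.Perm (Fin d)) :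
    permDist z w ≤ tupleDist z (w ∘ σ) :=
  Finset.inf'_le _ (Finset.mem_univ σ)

theorem exists_permDist_eq {d : ℕ} (z w : Fin d → ℂ) :
    ∃ σ : Equiv.Perm (Fin d), permDist z w = tupleDist z (w ∘ σ) := by
  obtain ⟨σ, -, h⟩ := Finset.exists_mem_eq_inf' (s := Finset.univ) Finset.univ_nonempty
    fun σ : Equiv.Perm (Fin d) => tupleDist z (w ∘ σ)
  exact ⟨σ, h⟩

theorem permDist_comp_le {d : ℕ} (z w : Fin d → ℂ) (σ τ : Equiv.Perm (Fin d)) :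
    permDist (z ∘ σ) (w ∘ τ) ≤ permDist z w := by
  obtain ⟨ρ, h⟩ := exists_permDist_eq z w
  rw [h, ← tupleDist_comp z (w ∘ ρ) σ]
  refine (permDist_le _ _ (τ⁻¹ * ρ * σ)).trans_eq ?_
  congr 1
  ext i
  simp

theorem permDist_congr {d : ℕ} {z w z' w' : Fin d → ℂ} (hz : z ≈ z') (hw : w ≈ w') :
    permDist z w = permDist z' w' := by
  have key : ∀ {z w z' w' : Fin d → ℂ}, z ≈ z' → w ≈ w' → permDist z' w' ≤ permDist z w := by
    rintro z w _ _ ⟨σ, rfl⟩ ⟨τ, rfl⟩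
    exact permDist_comp_le z w σ τ
  exact le_antisymm (key (Setoid.symm hz) (Setoid.symm hw)) (key hz hw)

/-- The metric `𝐝([z],[w]) = min_σ (1/√d) ‖z - σ w‖₂` on unordered tuples. -/
instance {d : ℕ} : Dist (UTuple d) where
  dist := Quotient.lift₂ permDist fun _ _ _ _ hz hw => permDist_congr hz hw

theorem dist_mk {d : ℕ} (z w : Fin d → ℂ) : dist (UTuple.mk z) (UTuple.mk w) = permDist z w := rfl

theorem UTuple.exists_rep {d : ℕ} (s : UTuple d) : ∃ z, UTuple.mk z = s := Quotient.exists_rep s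

instance {d : ℕ} : MetricSpace (UTuple d) where
  dist_self s := by
    obtain ⟨z, rfl⟩ := s.exists_rep
    rw [dist_mk]
    refine le_antisymm ((permDist_le z z 1).trans_eq ?_) ?_
    · simp [tupleDist]
    · obtain ⟨σ, h⟩ := exists_permDist_eq z z
      rw [h]; exact tupleDist_nonneg _ _
  dist_comm s t := by
    obtain ⟨z, rfl⟩ := s.exists_rep
    obtain ⟨w, rfl⟩ := t.exists_rep
    have key : ∀ z w : Fin d → ℂ, permDist z w ≤ permDist w z := by
      intro z w
      obtain ⟨σ, h⟩ := exists_permDist_eq w z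
      rw [h, tupleDist_comm]
      refine (permDist_le z w σ⁻¹).trans_eq ?_
      rw [← tupleDist_comp z _ σ]
      congr 1
      ext i
      simp
    exact le_antisymm (key z w) (key w z)
  dist_triangle s t u := by
    obtain ⟨z, rfl⟩ := s.exists_rep
    obtain ⟨w, rfl⟩ := t.exists_rep
    obtain ⟨v, rfl⟩ := u.exists_rep
    simp only [dist_mk]
    obtain ⟨σ, hσ⟩ := exists_permDist_eq z w
    obtain ⟨τ, hτ⟩ := exists_permDist_eq w v
    rw [hσ, hτ]
    refine (permDist_le z v (τ * σ)).trans ((tupleDist_triangle _ (w ∘ σ) _).trans_eq ?_)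
    rw [← tupleDist_comp w _ σ]
    rfl
  eq_of_dist_eq_zero {s t} h := by
    obtain ⟨z, rfl⟩ := s.exists_rep
    obtain ⟨w, rfl⟩ := t.exists_rep
    rw [dist_mk] at h
    obtain ⟨σ, hσ⟩ := exists_permDist_eq z w
    have := eq_of_tupleDist_eq_zero (hσ ▸ h)
    exact Quotient.sound (Setoid.symm ⟨σ, this⟩)

/-! ### Almgren's embedding -/

/-- The Almgren map of the linear form `η(z) = Re (θ z)`: the numbers `η(z i)` arranged in
increasing order. -/
def almgrenMap {d : ℕ} (θ : ℂ) : UTuple d → Fin d → ℝ :=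
  Quotient.lift
    (fun z : Fin d → ℂ =>
      (fun i => (θ * z i).re) ∘ Tuple.sort fun i => (θ * z i).re)
    (by
      rintro z _ ⟨σ, rfl⟩
      exact (Tuple.comp_perm_comp_sort_eq_comp_sort
        (f := fun i => (θ * z i).re) (σ := σ)).symm)

/-- The property required of the linear forms `η_l(z) = Re (θ_l z)`, `l = 1, …, h`, in the
construction of an Almgren embedding: the `θ_l` are unit complex numbers, and there is `α > 0`
such that for any `d²` complex numbers some `η_l` satisfies `|η_l(z_k)| ≥ α |z_k|` for all `k`. -/
def IsAlmgrenFamily (d : ℕ) {h : ℕ} (θ : Fin h → ℂ) : Prop :=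
  (∀ l, ‖θ l‖ = 1) ∧
    ∃ α : ℝ, 0 < α ∧ ∀ z : Fin (d ^ 2) → ℂ, ∃ l, ∀ k, α * ‖z k‖ ≤ |(θ l * z k).re|

/-- The map `Δ = h^(-1/2) (H_1, …, H_h)` with values in `ℝ^N`, `N = dh`, where `H_l` is the Almgren
map of `z ↦ Re (θ_l z)`. It is called an Almgren embedding if `IsAlmgrenFamily d θ` holds. -/
def almgrenEmbedding {d h : ℕ} (θ : Fin h → ℂ) (s : UTuple d) :
    EuclideanSpace ℝ (Fin h × Fin d) :=
  WithLp.toLp 2 fun p => (1 / √(h : ℝ)) * almgrenMap (θ p.1) s p.2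

/-! ### Sobolev functions on a bounded open interval -/

/-- Lebesgue measure on the interval `(a, b)`. -/
def intervalMeasure (a b : ℝ) : Measure (Ioo a b) := Measure.comap Subtype.val volume

section Sobolev

variable {a b : ℝ} {E : Type*} [NormedAddCommGroup E] [NormedSpace ℝ E]

/-- `v` is a distributional derivative of `u` on the interval `(a, b)`. -/
def IsWeakDeriv (u v : Ioo a b → E) : Prop :=
  LocallyIntegrable u (intervalMeasure a b) ∧ LocallyIntegrable v (intervalMeasure a b) ∧
    ∀ φ : ℝ → ℝ, ContDiff ℝ (⊤ : ℕ∞) φ → HasCompactSupport φ → tsupport φ ⊆ Ioo a b →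
      ∫ x : Ioo a b, deriv φ x • u x ∂intervalMeasure a b =
        -∫ x : Ioo a b, φ x • v x ∂intervalMeasure a b

/-- The norm `‖u‖_{L^q} + ‖u'‖_{L^q}` of `W^{1,q}((a,b),E)`, where `u'` is the distributional
derivative, which is unique up to null sets. The value is `∞` if `u` has no distributional
derivative in `L^1_loc`. -/
def sobolevNorm (q : ℝ≥0∞) (u : Ioo a b → E) : ℝ≥0∞ :=
  eLpNorm u q (intervalMeasure a b) + ⨅ (v : Ioo a b → E) (_ : IsWeakDeriv u v), eLpNorm v q (intervalMeasure a b)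

theorem integrable_smul_of_locallyIntegrable {u : Ioo a b → E} (hu : LocallyIntegrable u (intervalMeasure a b))
    {ψ : ℝ → ℝ} (hψ : Continuous ψ) (hc : HasCompactSupport ψ) (hs : tsupport ψ ⊆ Ioo a b) :
    Integrable (fun x : Ioo a b => ψ x • u x) (intervalMeasure a b) := by
  have : LocallyCompactSpace (Ioo a b) := isOpen_Ioo.locallyCompactSpace
  refine hu.integrable_smul_left_of_hasCompactSupport (g := fun x : Ioo a b => ψ x)
    (hψ.comp continuous_subtype_val) ?_
  refine HasCompactSupport.intro (K := Subtype.val ⁻¹' tsupport ψ) ?_ ?_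
  · rw [IsInducing.subtypeVal.isCompact_preimage_iff (by rwa [Subtype.range_coe])]
    exact hc
  · intro x hx
    exact image_eq_zero_of_notMem_tsupport hx

theorem IsWeakDeriv.zero : IsWeakDeriv (0 : Ioo a b → E) 0 :=
  ⟨locallyIntegrable_zero, locallyIntegrable_zero, fun φ _ _ _ => by simp⟩

theorem IsWeakDeriv.neg {u v : Ioo a b → E} (h : IsWeakDeriv u v) : IsWeakDeriv (-u) (-v) := by
  refine ⟨h.1.neg, h.2.1.neg, fun φ h1 h2 h3 => ?_⟩
  simp only [Pi.neg_apply, smul_neg, integral_neg]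
  rw [h.2.2 φ h1 h2 h3]

theorem IsWeakDeriv.add {u v u' v' : Ioo a b → E} (h : IsWeakDeriv u v) (h' : IsWeakDeriv u' v') :
    IsWeakDeriv (u + u') (v + v') := by
  refine ⟨h.1.add h'.1, h.2.1.add h'.2.1, fun φ h1 h2 h3 => ?_⟩
  have hd : Continuous (deriv φ) := h1.continuous_deriv (by simp)
  have hs : tsupport (deriv φ) ⊆ Ioo a b := (closure_minimal
    (support_deriv_subset) (isClosed_tsupport φ)).trans h3
  have i1 := integrable_smul_of_locallyIntegrable h.1 hd h2.deriv hs
  have i2 := integrable_smul_of_locallyIntegrable h'.1 hd h2.deriv hs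
  have i3 := integrable_smul_of_locallyIntegrable h.2.1 h1.continuous h2 h3
  have i4 := integrable_smul_of_locallyIntegrable h'.2.1 h1.continuous h2 h3
  simp only [Pi.add_apply, smul_add]
  rw [integral_add i1 i2, integral_add i3 i4, h.2.2 φ h1 h2 h3, h'.2.2 φ h1 h2 h3, neg_add]

theorem sobolevNorm_zero (q : ℝ≥0∞) : sobolevNorm q (0 : Ioo a b → E) = 0 := by
  have : ⨅ (v : Ioo a b → E) (_ : IsWeakDeriv 0 v), eLpNorm v q (intervalMeasure a b) ≤ 0 :=
    (iInf₂_le 0 IsWeakDeriv.zero).trans_eq eLpNorm_zero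
  simp [sobolevNorm, le_antisymm this bot_le]

theorem sobolevNorm_neg (q : ℝ≥0∞) (u : Ioo a b → E) : sobolevNorm q (-u) = sobolevNorm q u := by
  have key : ∀ u : Ioo a b → E, sobolevNorm q (-u) ≤ sobolevNorm q u := by
    intro u
    unfold sobolevNorm
    rw [eLpNorm_neg]
    refine add_le_add le_rfl (le_iInf₂ fun v hv => ?_)
    exact (iInf₂_le (-v) hv.neg).trans_eq (eLpNorm_neg _ _ _)
  exact le_antisymm (key u) (by simpa using key (-u))

theorem sobolevNorm_add_le {q : ℝ≥0∞} (hq : 1 ≤ q) (u u' : Ioo a b → E) :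
    sobolevNorm q (u + u') ≤ sobolevNorm q u + sobolevNorm q u' := by
  by_cases h : ∃ v, IsWeakDeriv u v
  · by_cases h' : ∃ v, IsWeakDeriv u' v
    · obtain ⟨v₀, hv₀⟩ := h
      obtain ⟨v₀', hv₀'⟩ := h'
      unfold sobolevNorm
      rw [add_add_add_comm]
      refine add_le_add (eLpNorm_add_le hv₀.1.aestronglyMeasurable
        hv₀'.1.aestronglyMeasurable hq) ?_
      refine ENNReal.le_of_forall_pos_le_add fun ε hε hfin => ?_
      have hε' : (0 : ℝ≥0∞) < ε / 2 := by
        simpa using hε.ne'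
      obtain ⟨hA, hB⟩ := ENNReal.add_lt_top.mp hfin
      have hA' := ENNReal.lt_add_right hA.ne hε'.ne'
      have hB' := ENNReal.lt_add_right hB.ne hε'.ne'
      obtain ⟨v, hv⟩ := iInf_lt_iff.mp hA'
      obtain ⟨hv, hvA⟩ := iInf_lt_iff.mp hv
      obtain ⟨v', hv'⟩ := iInf_lt_iff.mp hB'
      obtain ⟨hv', hvB⟩ := iInf_lt_iff.mp hv'
      refine (iInf₂_le (v + v') (hv.add hv')).trans ?_
      refine (eLpNorm_add_le hv.2.1.aestronglyMeasurable
        hv'.2.1.aestronglyMeasurable hq).trans ?_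
      refine (add_le_add hvA.le hvB.le).trans_eq ?_
      rw [add_add_add_comm, ENNReal.add_halves]
    · have : sobolevNorm q u' = ∞ := by
        unfold sobolevNorm
        simp only [not_exists] at h'
        simp [h']
      simp [this]
  · have : sobolevNorm q u = ∞ := by
      unfold sobolevNorm
      simp only [not_exists] at h
      simp [h]
    simp [this]

end Sobolev

/-! ### `d`-valued Sobolev functions -/

/-- The intrinsic definition of the class `W^{1,q}((a,b), 𝒜_d(ℂ))`: there is `0 ≤ φ ∈ L^q` such that,
for all `T`, the function `𝐝(f, T)` is in `W^{1,q}` and `|𝐝(f, T)'| ≤ φ` almost everywhere. -/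
def MemSobolev {d : ℕ} {a b : ℝ} (q : ℝ≥0∞) (f : Ioo a b → UTuple d) : Prop :=
  ∃ φ : Ioo a b → ℝ, 0 ≤ φ ∧ MemLp φ q (intervalMeasure a b) ∧
    ∀ T : UTuple d, MemLp (fun x => dist (f x) T) q (intervalMeasure a b) ∧
      ∃ v : Ioo a b → ℝ, MemLp v q (intervalMeasure a b) ∧ IsWeakDeriv (fun x => dist (f x) T) v ∧
        ∀ᵐ x ∂intervalMeasure a b, |v x| ≤ φ x

/-- The space `W^{1,q}((a,b), 𝒜_d(ℂ))`; every class of almost everywhere equal functions is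
represented by its continuous representative. -/
def SobolevCurve (d : ℕ) (a b : ℝ) (q : ℝ≥0∞) : Type :=
  {f : Ioo a b → UTuple d // Continuous f ∧ MemSobolev q f}

instance {d : ℕ} {a b : ℝ} {q : ℝ≥0∞} :
    CoeFun (SobolevCurve d a b q) fun _ => Ioo a b → UTuple d :=
  ⟨Subtype.val⟩

/-- `f` is differentiable at `x₀` with `f(x₀) = [z]` and differential `[L]`, where `L i` is the
derivative of the branch through `z i`. -/
def HasDDerivAt {d : ℕ} {a b : ℝ} (f : Ioo a b → UTuple d) (x₀ : Ioo a b) (z L : Fin d → ℂ) :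
    Prop :=
  f x₀ = UTuple.mk z ∧ (∀ i j, z i = z j → L i = L j) ∧
    (fun x : Ioo a b =>
        dist (f x) (UTuple.mk fun i => z i + L i * (((x : ℝ) - (x₀ : ℝ) : ℝ) : ℂ)))
      =o[𝓝 x₀] fun x : Ioo a b => (x : ℝ) - (x₀ : ℝ)

/-- The pointwise distance `𝐬₁(f,g)(x)` of the differentials: if `f(x) = [z]`, `Df(x) = [L]` and
`g(x) = [w]`, `Dg(x) = [M]` with corresponding indices, it is the maximum of
`(1/√d) (∑ |L i - M (τ i)|²)^(1/2)` over all permutations `τ` that realize the distance of `f(x)`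
and `g(x)`. These are the permutations that are the first minimizer for some ordering of the
symmetric group. The choice of the numberings does not matter. The value is `0` where `f` or `g` is
not differentiable. -/
def derivDist {d : ℕ} {a b : ℝ} (f g : Ioo a b → UTuple d) (x : Ioo a b) : ℝ≥0∞ :=
  ⨆ (z : Fin d → ℂ) (L : Fin d → ℂ) (_ : HasDDerivAt f x z L)
    (w : Fin d → ℂ) (M : Fin d → ℂ) (_ : HasDDerivAt g x w M)
    (τ : Equiv.Perm (Fin d)) (_ : tupleDist z (w ∘ τ) = dist (f x) (g x)),
    ENNReal.ofReal (tupleDist L (M ∘ τ))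

/-- The intrinsic semimetric `𝐝^{1,q}(f,g) = ‖𝐝(f,g)‖_{L^∞} + ‖𝐬₁(f,g)‖_{L^q}`. -/
def intrinsicDist {d : ℕ} {a b : ℝ} {q : ℝ≥0∞} (f g : SobolevCurve d a b q) : ℝ≥0∞ :=
  eLpNorm (fun x => dist (f x) (g x)) ∞ (intervalMeasure a b) + eLpNorm (derivDist f g) q (intervalMeasure a b)

/-- The norm `‖Δ ∘ f - Δ ∘ g‖_{W^{1,q}}` for the map `Δ` built from `θ`. -/
def almgrenDist {d : ℕ} {a b : ℝ} {q : ℝ≥0∞} {h : ℕ} (θ : Fin h → ℂ)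
    (f g : SobolevCurve d a b q) : ℝ≥0∞ :=
  sobolevNorm q fun x => almgrenEmbedding θ (f x) - almgrenEmbedding θ (g x)

/-- The space `W^{1,q}((a,b), 𝒜_d(ℂ))` with the distance `‖Δ ∘ f - Δ ∘ g‖_{W^{1,q}}`. -/
@[reducible] def almgrenMetric (d : ℕ) (a b : ℝ) {q : ℝ≥0∞} (hq : 1 ≤ q) {h : ℕ} (θ : Fin h → ℂ) :
    PseudoEMetricSpace (SobolevCurve d a b q) where
  edist := almgrenDist θ
  edist_self f := by
    simp only [almgrenDist, sub_self]
    exact sobolevNorm_zero q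
  edist_comm f g := by
    unfold almgrenDist
    rw [← sobolevNorm_neg]
    congr 1
    ext1 x
    simp
  edist_triangle f g k := by
    unfold almgrenDist
    refine le_trans (le_of_eq ?_) (sobolevNorm_add_le hq _ _)
    congr 1
    ext1 x
    simp

/-- The topology on `W^{1,q}((a,b), 𝒜_d(ℂ))` induced by the distance
`‖Δ ∘ f - Δ ∘ g‖_{W^{1,q}}`. -/
@[reducible] def almgrenTopology (d : ℕ) (a b : ℝ) {q : ℝ≥0∞} (hq : 1 ≤ q) {h : ℕ} (θ : Fin h → ℂ) :
    TopologicalSpace (SobolevCurve d a b q) :=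
  (almgrenMetric d a b hq θ).toUniformSpace.toTopologicalSpace

end DValued

end

open DValued

open scoped NNReal

noncomputable section

/-! The map Δ is bi-Lipschitz, so Δ ∘ f is absolutely continuous for every Sobolev curve f and has
almost everywhere a classical derivative, which is also its weak derivative. Hence `almgrenDist` is
computed from pointwise derivatives, and the question becomes a pointwise comparison of |(Δ ∘ g)' -
(Δ ∘ f)'| with 𝐬₁(g, f).

At a point where Δ ∘ f is differentiable, f is differentiable too, and (Δ ∘ f)' consists of the
numbers h^(-1/2) Re(θ_l L_i), arranged in the order that sorts Re(θ_l z_i)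
(`HasDDerivAt.isCompatibleDeriv`, `IsAlmgrenFamily.exists_hasDDerivAt`). Match g(x) = [z] optimally
with f(x) = [w]. If the matching moves points by less than half of every nonzero gap between the
numbers Re(θ_l z_i), then a permutation sorting the forms on the matched w also sorts them on z.
Both derivative arrays are then rearranged by the same permutations, and |(Δ ∘ g)' - (Δ ∘ f)'| is
comparable to the distance of the matched differentials, whichever optimal matching is taken
(`norm_sub_sq_of_notMem_collisionSet`).

At the remaining points, those of `collisionSet`, the two quantities are unrelated, but each is
bounded by a multiple of the other plus a multiple of |(Δ ∘ g)'|. This error involves the derivative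
of the limit curve g only. If f_n → g pointwise almost everywhere, almost every x eventually leaves
the collision sets, so the error tends to zero in L^q by dominated convergence; this is where q < ∞
enters. The uniform convergence needed in 𝐝^{1,q} comes from the embedding of W^{1,q} into the
bounded functions.

Since 𝐝^{1,q} does not involve Δ, all Almgren distances have the same convergent sequences with the
same limits, hence the same topology. -/

namespace DValued

/-! ### Transfer between the interval as a subtype and the real line -/

section ZeroExtension

variable {a b : ℝ} {E : Type*} [NormedAddCommGroup E]

/-- The extension by zero to the real line of a function on the interval `(a, b)`. -/
def zeroExt (u : Ioo a b → E) : ℝ → E := Function.extend Subtype.val u 0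

@[simp] theorem zeroExt_coe (u : Ioo a b → E) (x : Ioo a b) : zeroExt u x = u x :=
  Subtype.val_injective.extend_apply u 0 x

theorem zeroExt_of_mem (u : Ioo a b → E) {t : ℝ} (ht : t ∈ Ioo a b) : zeroExt u t = u ⟨t, ht⟩ :=
  zeroExt_coe u ⟨t, ht⟩

theorem zeroExt_of_notMem (u : Ioo a b → E) {t : ℝ} (ht : t ∉ Ioo a b) : zeroExt u t = 0 := by
  refine Function.extend_apply' _ _ _ ?_
  rintro ⟨x, rfl⟩
  exact ht x.2

theorem integral_intervalMeasure [NormedSpace ℝ E] (F : ℝ → E) :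
    ∫ x : Ioo a b, F x ∂intervalMeasure a b = ∫ t in Ioo a b, F t :=
  integral_subtype_comap measurableSet_Ioo F

theorem integrable_zeroExt {u : Ioo a b → E} (hu : Integrable u (intervalMeasure a b)) :
    Integrable (zeroExt u) := by
  have h1 : IntegrableOn (zeroExt u) (Ioo a b) := by
    unfold IntegrableOn
    rw [← map_comap_subtype_coe measurableSet_Ioo,
      (MeasurableEmbedding.subtype_coe measurableSet_Ioo).integrable_map_iff]
    convert hu using 1
    · ext x
      simp
    · rfl
  refine h1.integrable_of_forall_notMem_eq_zero fun t ht => zeroExt_of_notMem u ht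

theorem continuousOn_zeroExt {u : Ioo a b → E} (hu : Continuous u) :
    ContinuousOn (zeroExt u) (Ioo a b) := by
  rw [continuousOn_iff_continuous_domRestrict]
  convert hu using 1
  ext x
  simp

theorem ae_intervalMeasure_iff {p : ℝ → Prop} :
    (∀ᵐ x : Ioo a b ∂intervalMeasure a b, p x) ↔ ∀ᵐ t : ℝ, t ∈ Ioo a b → p t := by
  rw [← ae_restrict_iff' measurableSet_Ioo, ae_restrict_iff_subtype measurableSet_Ioo]
  rfl

theorem intervalMeasure_univ : intervalMeasure a b univ = ENNReal.ofReal (b - a) := by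
  unfold intervalMeasure
  rw [comap_subtype_coe_apply measurableSet_Ioo, image_univ, Subtype.range_coe, Real.volume_Ioo]

instance : IsFiniteMeasure (intervalMeasure a b) :=
  ⟨by rw [intervalMeasure_univ]; exact ENNReal.ofReal_lt_top⟩

theorem zeroExt_eventuallyEq (u : Ioo a b → E) (F : ℝ → E) (h : ∀ x : Ioo a b, u x = F x)
    (x : Ioo a b) : zeroExt u =ᶠ[𝓝 (x : ℝ)] F := by
  filter_upwards [isOpen_Ioo.mem_nhds x.2] with t ht
  rw [zeroExt_of_mem u ht, h]

end ZeroExtension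

/-! ### Test functions and the du Bois-Reymond lemma -/

section DuBoisReymond

variable {a b : ℝ}

theorem exists_Icc_of_isCompact_subset_Ioo (hab : a < b) {K : Set ℝ} (hK : IsCompact K)
    (hKs : K ⊆ Ioo a b) : ∃ c e, a < c ∧ c ≤ e ∧ e < b ∧ K ⊆ Icc c e := by
  rcases K.eq_empty_or_nonempty with rfl | hne
  · exact ⟨(a + b) / 2, (a + b) / 2, by linarith, le_rfl, by linarith, empty_subset _⟩
  · exact ⟨sInf K, sSup K, (hKs (hK.sInf_mem hne)).1,
      csInf_le_csSup hne hK.bddBelow hK.bddAbove, (hKs (hK.sSup_mem hne)).2,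
      fun x hx => ⟨csInf_le hK.bddBelow hx, le_csSup hK.bddAbove hx⟩⟩

/-- A test function with mean zero is the derivative of a test function. -/
theorem exists_testFunction_deriv_eq (hab : a < b) {ψ : ℝ → ℝ} (h1 : ContDiff ℝ (⊤ : ℕ∞) ψ)
    (h2 : HasCompactSupport ψ) (h3 : tsupport ψ ⊆ Ioo a b) (h0 : ∫ t, ψ t = 0) :
    ∃ φ : ℝ → ℝ, ContDiff ℝ (⊤ : ℕ∞) φ ∧ HasCompactSupport φ ∧ tsupport φ ⊆ Ioo a b ∧
      deriv φ = ψ := by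
  obtain ⟨c, e, hac, hce, heb, hs⟩ := exists_Icc_of_isCompact_subset_Ioo hab h2 h3
  have hd : ∀ x, HasDerivAt (fun x => ∫ t in a..x, ψ t) (ψ x) x := fun x =>
    intervalIntegral.integral_hasDerivAt_right (h1.continuous.intervalIntegrable _ _)
      h1.continuous.aestronglyMeasurable.stronglyMeasurableAtFilter h1.continuous.continuousAt
  have hderiv : deriv (fun x => ∫ t in a..x, ψ t) = ψ := funext fun x => (hd x).deriv
  have hz : ∀ x, x ∉ Icc c e → ψ x = 0 := fun x hx => by
    by_contra h
    exact hx (hs (subset_tsupport _ h))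
  have hzero : ∀ x, x ∉ Icc c e → ∫ t in a..x, ψ t = 0 := by
    intro x hx
    rcases not_and_or.mp hx with hx | hx
    · rw [intervalIntegral.integral_congr (g := fun _ => (0 : ℝ))]
      · simp
      · intro t ht
        refine hz t fun h => hx ?_
        rcases le_total a x with h' | h'
        · rw [uIcc_of_le h'] at ht
          exact h.1.trans ht.2
        · rw [uIcc_of_ge h'] at ht
          linarith [ht.2, h.1]
    -- To the right of the support the primitive equals the full integral of ψ, which vanishes by
    -- hypothesis.
    · have hx : e < x := not_le.mp hx
      rw [intervalIntegral.integral_of_le (by linarith), ← h0]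
      refine setIntegral_eq_integral_of_forall_compl_eq_zero fun t ht => hz t fun h => ht ?_
      exact ⟨by linarith [h.1], by linarith [h.2]⟩
  have hsub : tsupport (fun x => ∫ t in a..x, ψ t) ⊆ Icc c e := by
    refine closure_minimal (fun x hx => ?_) isClosed_Icc
    by_contra h
    exact hx (hzero x h)
  refine ⟨fun x => ∫ t in a..x, ψ t, ?_, ?_, ?_, hderiv⟩
  · refine contDiff_infty_iff_deriv.mpr ⟨fun x => (hd x).differentiableAt, ?_⟩
    rw [hderiv]
    exact h1
  · exact HasCompactSupport.of_support_subset_isCompact (isCompact_Icc (a := c) (b := e))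
      (subset_closure.trans hsub)
  · exact hsub.trans fun x hx => ⟨by linarith [hx.1], by linarith [hx.2]⟩

theorem exists_testFunction_integral_eq_one (hab : a < b) :
    ∃ χ : ℝ → ℝ, ContDiff ℝ (⊤ : ℕ∞) χ ∧ HasCompactSupport χ ∧ tsupport χ ⊆ Ioo a b ∧
      ∫ t, χ t = 1 := by
  let B : ContDiffBump ((a + b) / 2) :=
    { rIn := (b - a) / 8, rOut := (b - a) / 4, rIn_pos := by linarith, rIn_lt_rOut := by linarith }
  refine ⟨B.normed volume, B.contDiff_normed, B.hasCompactSupport_normed, ?_, B.integral_normed⟩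
  rw [B.tsupport_normed_eq, Real.closedBall_eq_Icc]
  intro x hx
  simp only [B, mem_Icc] at hx
  exact ⟨by linarith [hx.1], by linarith [hx.2]⟩

theorem integrable_testFunction_mul {g : ℝ → ℝ} (hg : ContinuousOn g (Ioo a b)) {ψ : ℝ → ℝ}
    (h1 : Continuous ψ) (h2 : HasCompactSupport ψ) (h3 : tsupport ψ ⊆ Ioo a b) :
    Integrable fun t => ψ t * g t := by
  have h : IntegrableOn (fun t => ψ t * g t) (tsupport ψ) :=
    (h1.continuousOn.mul (hg.mono h3)).integrableOn_compact h2
  refine h.integrable_of_forall_notMem_eq_zero fun t ht => ?_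
  rw [image_eq_zero_of_notMem_tsupport ht, zero_mul]

/-- The du Bois-Reymond lemma. -/
theorem exists_eq_const_of_integral_deriv_mul_eq_zero (hab : a < b) {g : ℝ → ℝ}
    (hg : ContinuousOn g (Ioo a b))
    (h : ∀ φ : ℝ → ℝ, ContDiff ℝ (⊤ : ℕ∞) φ → HasCompactSupport φ → tsupport φ ⊆ Ioo a b →
      ∫ t, deriv φ t * g t = 0) :
    ∃ c, ∀ t ∈ Ioo a b, g t = c := by
  obtain ⟨χ, x1, x2, x3, x4⟩ := exists_testFunction_integral_eq_one hab
  refine ⟨∫ t, χ t * g t, ?_⟩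
  set c := ∫ t, χ t * g t with hc
  have key : ∀ᵐ t : ℝ, t ∈ Ioo a b → g t - c = 0 := by
    refine isOpen_Ioo.ae_eq_zero_of_integral_contDiff_smul_eq_zero
      ((hg.sub continuousOn_const).locallyIntegrableOn measurableSet_Ioo) fun ψ h1 h2 h3 => ?_
    have hψχ : HasCompactSupport fun t => (∫ s, ψ s) * χ t := x2.mul_left
    have hs : tsupport (fun t => ψ t - (∫ s, ψ s) * χ t) ⊆ Ioo a b := by
      refine (tsupport_sub _ _).trans (union_subset h3 ?_)
      exact (closure_mono (Function.support_mul_subset_right _ _)).trans x3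
    -- Subtracting (∫ ψ) χ makes the mean zero, so the hypothesis applies and yields ∫ ψ g = (∫ ψ)
    -- c.
    obtain ⟨φ, p1, p2, p3, p4⟩ := exists_testFunction_deriv_eq hab
      (ψ := fun t => ψ t - (∫ s, ψ s) * χ t) (h1.sub (contDiff_const.mul x1)) (h2.sub hψχ) hs (by
        rw [integral_sub (h1.continuous.integrable_of_hasCompactSupport h2)
          ((x1.continuous.integrable_of_hasCompactSupport x2).const_mul _), integral_const_mul, x4]
        ring)
    have := h φ p1 p2 p3
    rw [p4] at this
    simp only [smul_eq_mul, mul_sub, sub_mul, mul_assoc] at this ⊢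
    have i1 := integrable_testFunction_mul hg h1.continuous h2 h3
    have i2 := integrable_testFunction_mul hg x1.continuous x2 x3
    rw [integral_sub i1 (i2.const_mul _), integral_const_mul] at this
    rw [integral_sub i1 ((h1.continuous.integrable_of_hasCompactSupport h2).mul_const c),
      integral_mul_const]
    exact this
  refine Measure.eqOn_open_of_ae_eq (μ := volume) (f := g) (g := fun _ => c) ?_ isOpen_Ioo hg
    continuousOn_const
  rw [EventuallyEq, ae_restrict_iff' measurableSet_Ioo]
  filter_upwards [key] with t ht hmem using sub_eq_zero.mp (ht hmem)

end DuBoisReymond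

/-! ### The fundamental theorem of calculus for weak derivatives -/

section FundamentalTheorem

variable {a b : ℝ}

theorem integral_eq_intervalIntegral_of_tsupport_subset {E : Type*} [NormedAddCommGroup E]
    [NormedSpace ℝ E] {c e : ℝ} (hce : c ≤ e) {F : ℝ → E}
    (hF : ∀ t, t ∉ Ioc c e → F t = 0) : ∫ t, F t = ∫ t in c..e, F t := by
  rw [intervalIntegral.integral_of_le hce]
  exact (setIntegral_eq_integral_of_forall_compl_eq_zero fun t ht => hF t ht).symm

/-- A compact subset of `(a, b)` is contained in `(c, e)` for some `a < c ≤ e < b`. -/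
theorem exists_Ioo_of_isCompact_subset_Ioo (hab : a < b) {K : Set ℝ} (hK : IsCompact K)
    (hKs : K ⊆ Ioo a b) : ∃ c e, a < c ∧ c ≤ e ∧ e < b ∧ K ⊆ Ioo c e := by
  obtain ⟨c, e, hac, hce, heb, hs⟩ := exists_Icc_of_isCompact_subset_Ioo hab hK hKs
  refine ⟨(a + c) / 2, (e + b) / 2, by linarith, by linarith, by linarith, fun x hx => ?_⟩
  exact ⟨by linarith [(hs hx).1], by linarith [(hs hx).2]⟩

/-- Integration by parts of an absolutely continuous function against a test function. -/
theorem integral_deriv_testFunction_mul (hab : a < b) {W : ℝ → ℝ}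
    (hW : ∀ c e, a < c → c ≤ e → e < b → AbsolutelyContinuousOnInterval W c e) {φ : ℝ → ℝ}
    (h1 : ContDiff ℝ (⊤ : ℕ∞) φ) (h2 : HasCompactSupport φ) (h3 : tsupport φ ⊆ Ioo a b) :
    ∫ t, deriv φ t * W t = -∫ t, φ t * deriv W t := by
  obtain ⟨c, e, hac, hce, heb, hs⟩ := exists_Ioo_of_isCompact_subset_Ioo hab h2 h3
  have hz : ∀ t, t ∉ Ioo c e → φ t = 0 := fun t ht =>
    image_eq_zero_of_notMem_tsupport fun h => ht (hs h)
  have hz' : ∀ t, t ∉ Ioo c e → deriv φ t = 0 := fun t ht =>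
    image_eq_zero_of_notMem_tsupport fun h => ht (hs (tsupport_deriv_subset h))
  have hφ : AbsolutelyContinuousOnInterval φ c e :=
    (h1.of_le (by exact_mod_cast le_top)).contDiffOn.absolutelyContinuousOnInterval
  have := hφ.integral_mul_deriv_eq_deriv_mul (hW c e hac hce heb)
  rw [integral_eq_intervalIntegral_of_tsupport_subset hce,
    integral_eq_intervalIntegral_of_tsupport_subset hce, this, hz c (by simp), hz e (by simp)]
  · ring
  · intro t ht
    rw [hz t fun h => ht (Ioo_subset_Ioc_self h), zero_mul]
  · intro t ht
    rw [hz' t fun h => ht (Ioo_subset_Ioc_self h), zero_mul]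

theorem ae_deriv_primitive_eq {E : Type*} [NormedAddCommGroup E] [NormedSpace ℝ E]
    [CompleteSpace E] {v : ℝ → E} (hv : Integrable v) (c : ℝ) :
    ∀ᵐ t, HasDerivAt (fun x => ∫ s in c..x, v s) (v t) t := by
  filter_upwards [LocallyIntegrable.ae_hasDerivAt_integral hv.locallyIntegrable] with t ht using ht c

/-- Absolute continuity only involves differences of values, in which the base point c cancels; it
may therefore lie outside the interval. -/
theorem absolutelyContinuousOnInterval_primitive {v : ℝ → ℝ} (hv : Integrable v) (c x y : ℝ) :
    AbsolutelyContinuousOnInterval (fun x => ∫ s in c..x, v s) x y := by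
  have h := (hv.intervalIntegrable (a := x) (b := y)).absolutelyContinuousOnInterval_intervalIntegral
    (c := x) left_mem_uIcc
  refine Tendsto.congr (fun E => Finset.sum_congr rfl fun i _ => ?_) h
  simp only [Real.dist_eq]
  rw [intervalIntegral.integral_interval_sub_left hv.intervalIntegrable hv.intervalIntegrable,
    intervalIntegral.integral_interval_sub_left hv.intervalIntegrable hv.intervalIntegrable]

theorem integral_intervalMeasure_smul {E : Type*} [NormedAddCommGroup E] [NormedSpace ℝ E]
    (ψ : ℝ → ℝ) (u : Ioo a b → E) :
    ∫ x : Ioo a b, ψ x • u x ∂intervalMeasure a b = ∫ t, ψ t • zeroExt u t := by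
  have h := integral_intervalMeasure (a := a) (b := b) fun t => ψ t • zeroExt u t
  simp only [zeroExt_coe] at h
  rw [h]
  refine setIntegral_eq_integral_of_forall_compl_eq_zero fun t ht => ?_
  rw [zeroExt_of_notMem u ht, smul_zero]

/-- A continuous function is the integral of its distributional derivative. -/
theorem IsWeakDeriv.sub_eq_integral_real (hab : a < b) {u v : Ioo a b → ℝ} (hu : Continuous u)
    (hv : Integrable v (intervalMeasure a b)) (h : IsWeakDeriv u v) (x y : Ioo a b) :
    u y - u x = ∫ t in (x : ℝ)..y, zeroExt v t := by
  have hv' := integrable_zeroExt hv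
  set W : ℝ → ℝ := fun x => ∫ s in a..x, zeroExt v s with hWdef
  have hWc : Continuous W := intervalIntegral.continuous_primitive
    (fun _ _ => hv'.intervalIntegrable) a
  obtain ⟨c, hc⟩ := exists_eq_const_of_integral_deriv_mul_eq_zero hab
    -- The primitive W has weak derivative v, by integration by parts, so u - W has weak derivative
    -- zero and is constant.
    (g := fun t => zeroExt u t - W t) ((continuousOn_zeroExt hu).sub hWc.continuousOn) (by
      intro φ h1 h2 h3
      have hd : Continuous (deriv φ) := h1.continuous_deriv (by simp)
      have hs : tsupport (deriv φ) ⊆ Ioo a b := tsupport_deriv_subset.trans h3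
      have e1 := h.2.2 φ h1 h2 h3
      rw [integral_intervalMeasure_smul, integral_intervalMeasure_smul] at e1
      have e2 := integral_deriv_testFunction_mul hab (W := W)
        (fun c e _ _ _ => absolutelyContinuousOnInterval_primitive hv' a c e) h1 h2 h3
      have e3 : ∫ t, φ t * deriv W t = ∫ t, φ t * zeroExt v t := by
        refine integral_congr_ae ?_
        filter_upwards [ae_deriv_primitive_eq hv' a] with t ht
        rw [ht.deriv]
      simp only [mul_sub]
      rw [integral_sub (integrable_testFunction_mul (continuousOn_zeroExt hu) hd h2.deriv hs)
        (integrable_testFunction_mul hWc.continuousOn hd h2.deriv hs), e2, e3]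
      simp only [smul_eq_mul] at e1
      rw [e1, sub_self])
  have hx := hc x x.2
  have hy := hc y y.2
  simp only [zeroExt_coe] at hx hy
  rw [← intervalIntegral.integral_interval_sub_left (a := a) hv'.intervalIntegrable
    hv'.intervalIntegrable]
  change _ = W y - W x
  linarith

end FundamentalTheorem

/-! ### Reduction of vector-valued weak derivatives to coordinates -/

section Euclidean

variable {a b : ℝ} {ι : Type*} [Fintype ι]

theorem _root_.MeasureTheory.LocallyIntegrable.euclidean_apply {X : Type*} [TopologicalSpace X]
    [MeasurableSpace X] {μ : Measure X} {u : X → EuclideanSpace ℝ ι} (hu : LocallyIntegrable u μ)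
    (i : ι) : LocallyIntegrable (fun x => u x i) μ := fun x =>
  (hu x).imp fun _ hs => ⟨hs.1, (EuclideanSpace.proj (𝕜 := ℝ) i).integrable_comp hs.2⟩

theorem euclidean_integral_apply {X : Type*} [MeasurableSpace X] {μ : Measure X}
    {u : X → EuclideanSpace ℝ ι} (hu : Integrable u μ) (i : ι) :
    (∫ x, u x ∂μ) i = ∫ x, u x i ∂μ :=
  ((EuclideanSpace.proj (𝕜 := ℝ) i).integral_comp_comm hu).symm

theorem isWeakDeriv_euclidean {u v : Ioo a b → EuclideanSpace ℝ ι}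
    (hu : LocallyIntegrable u (intervalMeasure a b))
    (hv : LocallyIntegrable v (intervalMeasure a b)) :
    IsWeakDeriv u v ↔ ∀ i, IsWeakDeriv (fun x => u x i) (fun x => v x i) := by
  have key : ∀ φ : ℝ → ℝ, ContDiff ℝ (⊤ : ℕ∞) φ → HasCompactSupport φ → tsupport φ ⊆ Ioo a b →
      (∀ i, (∫ x : Ioo a b, deriv φ x • u x ∂intervalMeasure a b) i =
        ∫ x : Ioo a b, deriv φ x • u x i ∂intervalMeasure a b) ∧
      (∀ i, (-∫ x : Ioo a b, φ x • v x ∂intervalMeasure a b) i =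
        -∫ x : Ioo a b, φ x • v x i ∂intervalMeasure a b) := by
    intro φ h1 h2 h3
    have hd : Continuous (deriv φ) := h1.continuous_deriv (by simp)
    have i1 := integrable_smul_of_locallyIntegrable hu hd h2.deriv
      (tsupport_deriv_subset.trans h3)
    have i2 := integrable_smul_of_locallyIntegrable hv h1.continuous h2 h3
    refine ⟨fun i => by rw [euclidean_integral_apply i1]; rfl, fun i => ?_⟩
    rw [PiLp.neg_apply, euclidean_integral_apply i2]
    rfl
  constructor
  · rintro h i
    refine ⟨hu.euclidean_apply i, hv.euclidean_apply i, fun φ h1 h2 h3 => ?_⟩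
    rw [← (key φ h1 h2 h3).1 i, ← (key φ h1 h2 h3).2 i, h.2.2 φ h1 h2 h3]
  · intro h
    refine ⟨hu, hv, fun φ h1 h2 h3 => ?_⟩
    ext i
    rw [(key φ h1 h2 h3).1 i, (key φ h1 h2 h3).2 i, (h i).2.2 φ h1 h2 h3]

theorem zeroExt_euclidean_apply (u : Ioo a b → EuclideanSpace ℝ ι) (i : ι) (t : ℝ) :
    zeroExt u t i = zeroExt (fun x => u x i) t := by
  by_cases ht : t ∈ Ioo a b
  · rw [zeroExt_of_mem u ht, zeroExt_of_mem _ ht]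
  · rw [zeroExt_of_notMem u ht, zeroExt_of_notMem _ ht]
    rfl

/-- A continuous function is the integral of its distributional derivative. -/
theorem IsWeakDeriv.sub_eq_integral (hab : a < b) {u v : Ioo a b → EuclideanSpace ℝ ι}
    (hu : Continuous u) (hv : Integrable v (intervalMeasure a b)) (h : IsWeakDeriv u v)
    (x y : Ioo a b) : u y - u x = ∫ t in (x : ℝ)..y, zeroExt v t := by
  ext i
  have h' := (isWeakDeriv_euclidean h.1 h.2.1).mp h i
  have := h'.sub_eq_integral_real hab ((EuclideanSpace.proj (𝕜 := ℝ) i).continuous.comp hu)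
    ((EuclideanSpace.proj (𝕜 := ℝ) i).integrable_comp hv) x y
  have e := ContinuousLinearMap.intervalIntegral_comp_comm (EuclideanSpace.proj (𝕜 := ℝ) i)
    ((integrable_zeroExt hv).intervalIntegrable (a := (x : ℝ)) (b := y))
  refine this.trans (Eq.trans ?_ e)
  refine intervalIntegral.integral_congr fun t _ => ?_
  exact (zeroExt_euclidean_apply v i t).symm

end Euclidean

/-! ### Curves dominated by a primitive: classical derivative, Sobolev norm, sup bound -/

section AbsolutelyContinuous

variable {a b : ℝ} {ι : Type*} [Fintype ι]

theorem absolutelyContinuousOnInterval_of_dist_le {X Y : Type*} [PseudoMetricSpace X]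
    [PseudoMetricSpace Y] {F : ℝ → X} {U : ℝ → Y} {c e : ℝ}
    (hF : AbsolutelyContinuousOnInterval F c e)
    (h : ∀ x ∈ uIcc c e, ∀ y ∈ uIcc c e, dist (U x) (U y) ≤ dist (F x) (F y)) :
    AbsolutelyContinuousOnInterval U c e := by
  refine squeeze_zero' (Eventually.of_forall fun E => Finset.sum_nonneg fun _ _ => dist_nonneg)
    ?_ hF
  filter_upwards [mem_inf_of_right (mem_principal_self _)] with E hE
  exact Finset.sum_le_sum fun i hi => h _ (hE.1 i hi).1 _ (hE.1 i hi).2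

theorem norm_deriv_le_of_dist_le {E G : Type*} [NormedAddCommGroup E] [NormedSpace ℝ E]
    [NormedAddCommGroup G] [NormedSpace ℝ G] {U : ℝ → E} {F : ℝ → G} {U' : E} {F' : G} {x : ℝ}
    (hU : HasDerivAt U U' x) (hF : HasDerivAt F F' x)
    (h : ∀ᶠ y in 𝓝 x, dist (U y) (U x) ≤ dist (F y) (F x)) : ‖U'‖ ≤ ‖F'‖ := by
  rw [hasDerivAt_iff_tendsto_slope] at hU hF
  refine le_of_tendsto_of_tendsto hU.norm hF.norm ?_
  filter_upwards [nhdsWithin_le_nhds h] with y hy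
  rw [slope_def_module, slope_def_module, norm_smul, norm_smul, ← dist_eq_norm, ← dist_eq_norm]
  gcongr

theorem primitive_dist_eq {φ : ℝ → ℝ} (hφ : Integrable φ) (c x y : ℝ) :
    dist (∫ t in c..x, φ t) (∫ t in c..y, φ t) = |∫ t in x..y, φ t| := by
  rw [dist_comm, Real.dist_eq,
    intervalIntegral.integral_interval_sub_left hφ.intervalIntegrable hφ.intervalIntegrable]

/-- An absolutely continuous function has bounded variation, hence is differentiable almost
everywhere. The open interval is exhausted by countably many compact ones with rational endpoints,
so the exceptional sets remain null. -/
theorem ae_differentiableAt_of_forall_absolutelyContinuousOnInterval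
    {U : ℝ → EuclideanSpace ℝ ι}
    (hU : ∀ c e, a < c → c ≤ e → e < b → AbsolutelyContinuousOnInterval U c e) :
    ∀ᵐ t : ℝ, t ∈ Ioo a b → DifferentiableAt ℝ U t := by
  have key : ∀ c e : ℚ, ∀ᵐ t : ℝ, a < c → (c : ℝ) ≤ e → (e : ℝ) < b → t ∈ uIcc (c : ℝ) e →
      DifferentiableAt ℝ U t := by
    intro c e
    by_cases h : a < c ∧ (c : ℝ) ≤ e ∧ (e : ℝ) < b
    · filter_upwards
        [(hU c e h.1 h.2.1 h.2.2).boundedVariationOn.ae_differentiableAt_of_mem_uIcc]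
        with t ht _ _ _ hmem using ht hmem
    · exact Eventually.of_forall fun t h1 h2 h3 => absurd ⟨h1, h2, h3⟩ h
  filter_upwards [ae_all_iff.mpr fun c => ae_all_iff.mpr (key c)] with t ht hmem
  obtain ⟨c, hc1, hc2⟩ := exists_rat_btwn hmem.1
  obtain ⟨e, he1, he2⟩ := exists_rat_btwn hmem.2
  refine ht c e hc1 (hc2.trans he1).le he2 ?_
  rw [uIcc_of_le (hc2.trans he1).le]
  exact ⟨hc2.le, he1.le⟩

variable {u : Ioo a b → EuclideanSpace ℝ ι} {φ : Ioo a b → ℝ}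

theorem absolutelyContinuousOnInterval_zeroExt (hφ : Integrable φ (intervalMeasure a b))
    (h : ∀ x y : Ioo a b, dist (u x) (u y) ≤ |∫ t in (x : ℝ)..y, zeroExt φ t|) {c e : ℝ}
    (hac : a < c) (hce : c ≤ e) (heb : e < b) :
    AbsolutelyContinuousOnInterval (zeroExt u) c e := by
  have hφ' := integrable_zeroExt hφ
  refine absolutelyContinuousOnInterval_of_dist_le
    (absolutelyContinuousOnInterval_primitive hφ' a c e) fun x hx y hy => ?_
  rw [uIcc_of_le hce] at hx hy
  have hx' : x ∈ Ioo a b := ⟨hac.trans_le hx.1, hx.2.trans_lt heb⟩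
  have hy' : y ∈ Ioo a b := ⟨hac.trans_le hy.1, hy.2.trans_lt heb⟩
  rw [zeroExt_of_mem u hx', zeroExt_of_mem u hy', primitive_dist_eq hφ']
  exact h _ _

theorem ae_hasDerivAt_zeroExt (hφ : Integrable φ (intervalMeasure a b))
    (h : ∀ x y : Ioo a b, dist (u x) (u y) ≤ |∫ t in (x : ℝ)..y, zeroExt φ t|) :
    ∀ᵐ x : Ioo a b ∂intervalMeasure a b,
      HasDerivAt (zeroExt u) (deriv (zeroExt u) x) (x : ℝ) := by
  rw [ae_intervalMeasure_iff (p := fun t => HasDerivAt (zeroExt u) (deriv (zeroExt u) t) t)]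
  filter_upwards [ae_differentiableAt_of_forall_absolutelyContinuousOnInterval (U := zeroExt u)
    (fun c e h1 h2 h3 => absolutelyContinuousOnInterval_zeroExt hφ h h1 h2 h3)] with t ht hmem
  exact (ht hmem).hasDerivAt

theorem ae_norm_deriv_zeroExt_le (hφ : Integrable φ (intervalMeasure a b))
    (h : ∀ x y : Ioo a b, dist (u x) (u y) ≤ |∫ t in (x : ℝ)..y, zeroExt φ t|) :
    ∀ᵐ x : Ioo a b ∂intervalMeasure a b, ‖deriv (zeroExt u) x‖ ≤ ‖φ x‖ := by
  have hφ' := integrable_zeroExt hφ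
  have h2 : ∀ᵐ x : Ioo a b ∂intervalMeasure a b,
      HasDerivAt (fun x => ∫ s in a..x, zeroExt φ s) (zeroExt φ x) x :=
    ae_intervalMeasure_iff.mpr ((ae_deriv_primitive_eq hφ' a).mono fun _ h _ => h)
  filter_upwards [ae_hasDerivAt_zeroExt hφ h, h2] with x hx1 hx2
  rw [zeroExt_coe] at hx2
  refine norm_deriv_le_of_dist_le hx1 hx2 ?_
  filter_upwards [isOpen_Ioo.mem_nhds x.2] with y hy
  rw [zeroExt_of_mem u hy, zeroExt_coe, primitive_dist_eq hφ']
  exact h _ _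

theorem aestronglyMeasurable_deriv_zeroExt (u : Ioo a b → EuclideanSpace ℝ ι) :
    AEStronglyMeasurable (fun x : Ioo a b => deriv (zeroExt u) x) (intervalMeasure a b) :=
  ((measurable_deriv (zeroExt u)).comp measurable_subtype_coe).aestronglyMeasurable

/-- Domination by the primitive of φ makes each coordinate locally absolutely continuous, so
integration by parts holds with the classical derivative, which is integrable because it is bounded
by |φ|. -/
theorem isWeakDeriv_deriv_zeroExt (hab : a < b) (hu : Continuous u)
    (hφ : Integrable φ (intervalMeasure a b))
    (h : ∀ x y : Ioo a b, dist (u x) (u y) ≤ |∫ t in (x : ℝ)..y, zeroExt φ t|) :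
    IsWeakDeriv u fun x => deriv (zeroExt u) x := by
  have hV : Integrable (fun x : Ioo a b => deriv (zeroExt u) x) (intervalMeasure a b) :=
    hφ.mono (aestronglyMeasurable_deriv_zeroExt u) (ae_norm_deriv_zeroExt_le hφ h)
  have hul : LocallyIntegrable u (intervalMeasure a b) := hu.locallyIntegrable
  refine (isWeakDeriv_euclidean hul hV.locallyIntegrable).mpr fun i =>
    ⟨hul.euclidean_apply i, hV.locallyIntegrable.euclidean_apply i, fun ψ h1 h2 h3 => ?_⟩
  rw [integral_intervalMeasure_smul]
  have e1 := integral_deriv_testFunction_mul hab (W := zeroExt fun x => u x i) (fun c e k1 k2 k3 =>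
    absolutelyContinuousOnInterval_of_dist_le
      (absolutelyContinuousOnInterval_zeroExt hφ h k1 k2 k3) fun x _ y _ => by
        rw [← zeroExt_euclidean_apply, ← zeroExt_euclidean_apply]
        exact PiLp.dist_apply_le _ _ _) h1 h2 h3
  refine e1.trans (congrArg Neg.neg ?_)
  have e2 : ∫ t, ψ t * deriv (zeroExt fun x => u x i) t =
      ∫ t in Ioo a b, ψ t * deriv (zeroExt fun x => u x i) t := by
    refine (setIntegral_eq_integral_of_forall_compl_eq_zero fun t ht => ?_).symm
    rw [image_eq_zero_of_notMem_tsupport fun h => ht (h3 h), zero_mul]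
  rw [e2, ← integral_intervalMeasure]
  refine integral_congr_ae ?_
  filter_upwards [ae_hasDerivAt_zeroExt hφ h] with x hx
  have := (EuclideanSpace.proj (𝕜 := ℝ) i).hasFDerivAt.comp_hasDerivAt (x : ℝ) hx
  have e3 : (EuclideanSpace.proj (𝕜 := ℝ) i) ∘ zeroExt u = zeroExt fun x => u x i :=
    funext fun t => zeroExt_euclidean_apply u i t
  rw [e3] at this
  rw [this.deriv]
  rfl

/-- The difference is a weak derivative of zero, so it annihilates all test functions. -/
theorem IsWeakDeriv.ae_eq {v v' : Ioo a b → EuclideanSpace ℝ ι}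
    (hv : Integrable v (intervalMeasure a b)) (hv' : Integrable v' (intervalMeasure a b))
    (h : IsWeakDeriv u v) (h' : IsWeakDeriv u v') : v =ᵐ[intervalMeasure a b] v' := by
  have h0 := h.add h'.neg
  have hint : Integrable (zeroExt (v + -v')) := integrable_zeroExt (hv.add hv'.neg)
  have key : ∀ᵐ t : ℝ, t ∈ Ioo a b → zeroExt (v + -v') t = 0 := by
    refine isOpen_Ioo.ae_eq_zero_of_integral_contDiff_smul_eq_zero
      (hint.locallyIntegrable.locallyIntegrableOn _) fun ψ h1 h2 h3 => ?_
    have := h0.2.2 ψ h1 h2 h3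
    rw [add_neg_cancel] at this
    simp only [Pi.zero_apply, smul_zero, integral_zero] at this
    rw [integral_intervalMeasure_smul] at this
    exact neg_eq_zero.mp this.symm
  filter_upwards [ae_intervalMeasure_iff.mpr key] with x hx
  rw [zeroExt_coe] at hx
  exact add_neg_eq_zero.mp hx

/-- A competitor in the infimum either has infinite norm or lies in L^q, and then it agrees with V
almost everywhere. -/
theorem sobolevNorm_eq {q : ℝ≥0∞} (hq : 1 ≤ q) {V : Ioo a b → EuclideanSpace ℝ ι}
    (h : IsWeakDeriv u V) (hV : MemLp V q (intervalMeasure a b)) :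
    sobolevNorm q u = eLpNorm u q (intervalMeasure a b) + eLpNorm V q (intervalMeasure a b) := by
  unfold sobolevNorm
  congr 1
  refine le_antisymm (iInf₂_le V h) (le_iInf₂ fun v hv => ?_)
  by_cases htop : eLpNorm v q (intervalMeasure a b) = ∞
  · rw [htop]; exact le_top
  · have hv' : MemLp v q (intervalMeasure a b) :=
      ⟨hv.2.1.aestronglyMeasurable, lt_top_iff_ne_top.mpr htop⟩
    exact (eLpNorm_congr_ae (h.ae_eq (hV.integrable hq) (hv'.integrable hq) hv)).le

theorem IsWeakDeriv.enorm_sub_le (hab : a < b) {V : Ioo a b → EuclideanSpace ℝ ι}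
    (hu : Continuous u) (h : IsWeakDeriv u V) (hV : Integrable V (intervalMeasure a b))
    (x y : Ioo a b) : ‖u y - u x‖ₑ ≤ eLpNorm V 1 (intervalMeasure a b) := by
  rw [h.sub_eq_integral hab hu hV x y, ← ofReal_norm, intervalIntegral.norm_intervalIntegral_eq,
    ofReal_norm, eLpNorm_one_eq_lintegral_enorm]
  refine (enorm_integral_le_lintegral_enorm _).trans ?_
  have h1 : ∫⁻ x : Ioo a b, ‖V x‖ₑ ∂intervalMeasure a b =
      ∫⁻ t in Ioo a b, ‖zeroExt V t‖ₑ := by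
    unfold intervalMeasure
    rw [← lintegral_subtype_comap measurableSet_Ioo]
    simp
  rw [h1]
  refine lintegral_mono_set fun t ht => ?_
  rcases mem_uIoc.mp ht with ht | ht
  · exact ⟨x.2.1.trans ht.1, ht.2.trans_lt y.2.2⟩
  · exact ⟨y.2.1.trans ht.1, ht.2.trans_lt x.2.2⟩

/-- The embedding of `W^{1,q}` of a bounded interval into the bounded continuous functions. -/
theorem exists_enorm_le_mul_sobolev (ι : Type*) [Fintype ι] (hab : a < b) {q : ℝ≥0∞}
    (hq : 1 ≤ q) :
    ∃ C : ℝ≥0∞, C ≠ ∞ ∧ ∀ u V : Ioo a b → EuclideanSpace ℝ ι, Continuous u → IsWeakDeriv u V →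
      MemLp V q (intervalMeasure a b) → ∀ x, ‖u x‖ₑ ≤
        C * (eLpNorm u q (intervalMeasure a b) + eLpNorm V q (intervalMeasure a b)) := by
  set M := intervalMeasure a b univ with hM
  have hM0 : M ≠ 0 := by
    rw [hM, intervalMeasure_univ]
    simpa using hab
  have hMt : M ≠ ∞ := measure_ne_top _ _
  -- The Hölder constant for passing from L^q to L^1 on a set of measure M.
  set K := M ^ (1 / (1 : ℝ≥0∞).toReal - 1 / q.toReal) with hK
  have hKt : K ≠ ∞ := ENNReal.rpow_ne_top_of_ne_zero hM0 hMt
  refine ⟨K * (M⁻¹ + 1), ENNReal.mul_ne_top hKt (by simp [hM0]), fun u V hu h hV x => ?_⟩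
  have hVi := hV.integrable hq
  set A := eLpNorm u q (intervalMeasure a b)
  set B := eLpNorm V q (intervalMeasure a b)
  have hA : eLpNorm u 1 (intervalMeasure a b) ≤ A * K :=
    eLpNorm_le_eLpNorm_mul_rpow_measure_univ hq hu.aestronglyMeasurable
  have hB : eLpNorm V 1 (intervalMeasure a b) ≤ B * K :=
    eLpNorm_le_eLpNorm_mul_rpow_measure_univ hq hV.1
  -- Averaging |u(x)| ≤ |u(y)| + |u(x) - u(y)| over y, where the increment is at most the L^1 norm
  -- of V.
  have h1 : ‖u x‖ₑ * M ≤ A * K + B * K * M := by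
    calc ‖u x‖ₑ * M = ∫⁻ _ : Ioo a b, ‖u x‖ₑ ∂intervalMeasure a b := by rw [lintegral_const]
      _ ≤ ∫⁻ y : Ioo a b, (‖u y‖ₑ + B * K) ∂intervalMeasure a b := by
          refine lintegral_mono fun y => ?_
          calc ‖u x‖ₑ = ‖u y + (u x - u y)‖ₑ := by rw [add_sub_cancel]
            _ ≤ ‖u y‖ₑ + ‖u x - u y‖ₑ := enorm_add_le _ _
            _ ≤ ‖u y‖ₑ + B * K := by
                gcongr
                exact (h.enorm_sub_le hab hu hVi y x).trans hB
      _ = eLpNorm u 1 (intervalMeasure a b) + B * K * M := by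
          rw [lintegral_add_right _ measurable_const, lintegral_const,
            eLpNorm_one_eq_lintegral_enorm]
      _ ≤ A * K + B * K * M := by gcongr
  calc ‖u x‖ₑ = ‖u x‖ₑ * M * M⁻¹ := by
        rw [mul_assoc, ENNReal.mul_inv_cancel hM0 hMt, mul_one]
    _ ≤ (A * K + B * K * M) * M⁻¹ := by gcongr
    _ = K * (M⁻¹ * A + B) := by
        rw [add_mul, mul_assoc (B * K), ENNReal.mul_inv_cancel hM0 hMt]
        ring
    _ ≤ K * (M⁻¹ * A + B + (A + M⁻¹ * B)) := mul_le_mul' le_rfl le_self_add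
    _ = K * (M⁻¹ + 1) * (A + B) := by ring

end AbsolutelyContinuous

/-! ### Increments of a Sobolev curve -/

section Curve

variable {a b : ℝ} {d : ℕ} {q : ℝ≥0∞}

/-- For fixed y take T = f(y) in the definition: 𝐝(f, T) vanishes at y, so its value at x is the
integral of its weak derivative from y to x. The bound φ does not depend on T, hence it serves all
pairs of points. -/
theorem MemSobolev.exists_dist_le (hab : a < b) (hq : 1 ≤ q) {f : Ioo a b → UTuple d}
    (hfc : Continuous f) (hf : MemSobolev q f) :
    ∃ φ : Ioo a b → ℝ, MemLp φ q (intervalMeasure a b) ∧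
      ∀ x y : Ioo a b, dist (f x) (f y) ≤ |∫ t in (x : ℝ)..y, zeroExt φ t| := by
  obtain ⟨φ, -, hφ, h⟩ := hf
  refine ⟨φ, hφ, fun x y => ?_⟩
  obtain ⟨-, v, hv, hw, hle⟩ := h (f y)
  have e := hw.sub_eq_integral_real hab (hfc.dist continuous_const) (hv.integrable hq) x y
  rw [dist_self, zero_sub] at e
  calc dist (f x) (f y) = ‖∫ t in (x : ℝ)..y, zeroExt v t‖ := by
        rw [← e, norm_neg, Real.norm_of_nonneg dist_nonneg]
    _ ≤ _ := by
        refine intervalIntegral.norm_integral_le_abs_of_norm_le ?_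
          (integrable_zeroExt (hφ.integrable hq)).intervalIntegrable
        refine ae_restrict_of_ae ?_
        have hle' : ∀ᵐ t : ℝ, t ∈ Ioo a b → ‖zeroExt v t‖ ≤ zeroExt φ t := by
          rw [← ae_intervalMeasure_iff]
          simpa using hle
        filter_upwards [hle'] with t ht
        by_cases hmem : t ∈ Ioo a b
        · exact ht hmem
        · rw [zeroExt_of_notMem _ hmem, zeroExt_of_notMem _ hmem, norm_zero]

end Curve

/-! ### Ordered representatives and the normalized distance -/

section Tuples

variable {d : ℕ}

theorem mk_comp (z : Fin d → ℂ) (σ : Equiv.Perm (Fin d)) : UTuple.mk (z ∘ σ) = UTuple.mk z :=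
  Quotient.sound (Setoid.symm ⟨σ, rfl⟩)

theorem dist_mk_le (z w : Fin d → ℂ) : dist (UTuple.mk z) (UTuple.mk w) ≤ tupleDist z w :=
  permDist_le z w 1

theorem exists_rep_tupleDist_eq (z : Fin d → ℂ) (t : UTuple d) :
    ∃ w, UTuple.mk w = t ∧ tupleDist z w = dist (UTuple.mk z) t := by
  obtain ⟨w, rfl⟩ := t.exists_rep
  obtain ⟨σ, hσ⟩ := exists_permDist_eq z w
  exact ⟨w ∘ σ, mk_comp w σ, hσ.symm⟩

theorem sqrt_mul_tupleDist (z w : Fin d → ℂ) :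
    √(d : ℝ) * tupleDist z w = √(∑ i, ‖z i - w i‖ ^ 2) := by
  unfold tupleDist
  rcases Nat.eq_zero_or_pos d with rfl | hd
  · simp
  · have : √(d : ℝ) ≠ 0 := by positivity
    field_simp

theorem norm_sub_le_tupleDist (z w : Fin d → ℂ) (i : Fin d) :
    ‖z i - w i‖ ≤ √(d : ℝ) * tupleDist z w := by
  rw [sqrt_mul_tupleDist]
  refine Real.le_sqrt_of_sq_le ?_
  exact Finset.single_le_sum (f := fun i => ‖z i - w i‖ ^ 2) (fun _ _ => by positivity)
    (Finset.mem_univ i)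

theorem tupleDist_le_of_forall_norm_le {z w : Fin d → ℂ} {r : ℝ} (hr : 0 ≤ r)
    (h : ∀ i, ‖z i - w i‖ ≤ r) : tupleDist z w ≤ r := by
  unfold tupleDist
  rcases Nat.eq_zero_or_pos d with rfl | hd
  · simpa using hr
  · have h1 : ∑ i, ‖z i - w i‖ ^ 2 ≤ d * r ^ 2 := by
      calc ∑ i, ‖z i - w i‖ ^ 2 ≤ ∑ _i : Fin d, r ^ 2 :=
            Finset.sum_le_sum fun i _ => pow_le_pow_left₀ (norm_nonneg _) (h i) 2
        _ = d * r ^ 2 := by simp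
    have h2 : √(∑ i, ‖z i - w i‖ ^ 2) ≤ √(d : ℝ) * r := by
      refine (Real.sqrt_le_sqrt h1).trans_eq ?_
      rw [Real.sqrt_mul (by positivity), Real.sqrt_sq hr]
    have h3 : 0 < √(d : ℝ) := by positivity
    rw [one_div, inv_mul_le_iff₀ h3]
    exact h2

end Tuples

/-! ### Sorting the values of a linear form -/

section Sorting

variable {d : ℕ}

theorem exists_perm_monotone (θ : ℂ) (z : Fin d → ℂ) :
    ∃ ρ : Equiv.Perm (Fin d), Monotone fun k => (θ * z (ρ k)).re :=
  ⟨_, Tuple.monotone_sort fun i => (θ * z i).re⟩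

theorem almgrenMap_mk_of_monotone {θ : ℂ} {z : Fin d → ℂ} {ρ : Equiv.Perm (Fin d)}
    (hρ : Monotone fun k => (θ * z (ρ k)).re) (k : Fin d) :
    almgrenMap θ (UTuple.mk z) k = (θ * z (ρ k)).re := by
  have := (Tuple.comp_sort_eq_comp_iff_monotone (f := fun i => (θ * z i).re) (σ := ρ)).mpr hρ
  exact (congrFun this k).symm

theorem monotone_almgrenMap (θ : ℂ) (s : UTuple d) : Monotone (almgrenMap θ s) := by
  obtain ⟨z, rfl⟩ := s.exists_rep
  exact Tuple.monotone_sort fun i => (θ * z i).re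

/-- Moving every entry by at most δ cannot reverse two entries that are more than 2δ apart. Ties in
x are harmless: the perturbation may break them in any order. -/
theorem monotone_comp_of_close {δ : ℝ} {x y : Fin d → ℝ} {ρ : Equiv.Perm (Fin d)}
    (hclose : ∀ i, |x i - y i| ≤ δ) (hsep : ∀ i j, x i ≠ x j → 2 * δ < |x i - x j|)
    (hρ : Monotone fun k => y (ρ k)) : Monotone fun k => x (ρ k) := by
  intro k k' hk
  by_contra hlt
  have hlt : x (ρ k') < x (ρ k) := not_le.mp hlt
  have h1 := hsep _ _ hlt.ne'
  rw [abs_of_pos (sub_pos.mpr hlt)] at h1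
  have h2 := abs_le.mp (hclose (ρ k))
  have h3 := abs_le.mp (hclose (ρ k'))
  have h4 : y (ρ k) ≤ y (ρ k') := hρ hk
  linarith [h2.1, h2.2, h3.1, h3.2]

/-- The rearrangement inequality: among all pairings of two finite families of reals, the monotone
one maximizes the sum of products, hence minimizes the sum of squared differences. -/
theorem sum_sq_almgrenMap_sub_le (θ : ℂ) (z w : Fin d → ℂ) :
    ∑ k, (almgrenMap θ (UTuple.mk z) k - almgrenMap θ (UTuple.mk w) k) ^ 2 ≤
      ∑ i, ((θ * (z i - w i)).re) ^ 2 := by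
  obtain ⟨ρ, hρ⟩ := exists_perm_monotone θ z
  obtain ⟨π, hπ⟩ := exists_perm_monotone θ w
  have h1 := (hρ.monovary hπ).sum_mul_comp_perm_le_sum_mul (σ := ρ.trans π.symm)
  rw [← Equiv.sum_comp ρ fun i => ((θ * (z i - w i)).re) ^ 2]
  have h2 := Equiv.sum_comp (ρ.trans π.symm) fun k => (θ * w (π k)).re ^ 2
  simp only [almgrenMap_mk_of_monotone hρ, almgrenMap_mk_of_monotone hπ, mul_sub, Complex.sub_re,
    sub_sq, Finset.sum_add_distrib, Finset.sum_sub_distrib, Equiv.trans_apply,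
    Equiv.apply_symm_apply, mul_assoc, ← Finset.mul_sum] at h1 h2 ⊢
  linarith

end Sorting

/-! ### The Almgren map is bi-Lipschitz; the algebra of its differential -/

section Embedding

variable {d h : ℕ} {θ : Fin h → ℂ}

theorem norm_sq_of_forall_apply_eq {V : EuclideanSpace ℝ (Fin h × Fin d)} {A : Fin h → Fin d → ℝ}
    (hV : ∀ l k, V (l, k) = 1 / √(h : ℝ) * A l k) :
    ‖V‖ ^ 2 = 1 / h * ∑ l, ∑ k, A l k ^ 2 := by
  rw [EuclideanSpace.norm_sq_eq, Fintype.sum_prod_type]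
  simp only [hV, Real.norm_eq_abs, sq_abs, mul_pow, ← Finset.mul_sum, div_pow, one_pow]
  rw [Real.sq_sqrt (by positivity)]

theorem norm_sq_almgrenEmbedding_sub (s t : UTuple d) :
    ‖almgrenEmbedding θ s - almgrenEmbedding θ t‖ ^ 2 =
      1 / h * ∑ l, ∑ k, (almgrenMap (θ l) s k - almgrenMap (θ l) t k) ^ 2 :=
  norm_sq_of_forall_apply_eq fun _ _ => (mul_sub _ _ _).symm

/-- The quadratic mean of the linear forms does not exceed the norm. -/
theorem mean_sum_sq_le (hθ : ∀ l, ‖θ l‖ = 1) (P : Fin d → ℂ) :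
    1 / (h : ℝ) * ∑ l, ∑ i, ((θ l * P i).re) ^ 2 ≤ ∑ i, ‖P i‖ ^ 2 := by
  have h1 : ∀ l, ∑ i, ((θ l * P i).re) ^ 2 ≤ ∑ i, ‖P i‖ ^ 2 := fun l =>
    Finset.sum_le_sum fun i _ => by
      have := Complex.abs_re_le_norm (θ l * P i)
      rw [norm_mul, hθ l, one_mul] at this
      exact sq_le_sq.mpr (by rwa [abs_of_nonneg (norm_nonneg (P i))])
  have h2 : ∑ l, ∑ i, ((θ l * P i).re) ^ 2 ≤ h * ∑ i, ‖P i‖ ^ 2 := by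
    refine (Finset.sum_le_sum fun l _ => h1 l).trans_eq ?_
    simp
  rcases Nat.eq_zero_or_pos h with rfl | hh
  · simp only [CharP.cast_eq_zero, div_zero, zero_mul]
    positivity
  · have : (0 : ℝ) < h := by exact_mod_cast hh
    rw [one_div, inv_mul_le_iff₀ this]
    exact h2

/-- For an optimal matching of the two tuples, sorting does not increase any sum of squares, and
each form is 1-Lipschitz. The factor √d undoes the normalization of 𝐝. -/
theorem dist_almgrenEmbedding_le (hθ : ∀ l, ‖θ l‖ = 1) (s t : UTuple d) :
    dist (almgrenEmbedding θ s) (almgrenEmbedding θ t) ≤ √(d : ℝ) * dist s t := by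
  obtain ⟨z, rfl⟩ := s.exists_rep
  obtain ⟨w, rfl, hw⟩ := exists_rep_tupleDist_eq z t
  rw [dist_eq_norm, ← hw, sqrt_mul_tupleDist]
  refine Real.le_sqrt_of_sq_le ?_
  rw [norm_sq_almgrenEmbedding_sub]
  refine le_trans ?_ (mean_sum_sq_le hθ fun i => z i - w i)
  exact mul_le_mul_of_nonneg_left
    (Finset.sum_le_sum fun l _ => sum_sq_almgrenMap_sub_le (θ l) z w) (by positivity)

theorem IsAlmgrenFamily.exists_form (hθ : IsAlmgrenFamily d θ) :
    ∃ α : ℝ, 0 < α ∧ ∀ P : Fin d → Fin d → ℂ, ∃ l, ∀ i j, α * ‖P i j‖ ≤ |(θ l * P i j).re| := by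
  obtain ⟨-, α, hα, h⟩ := hθ
  refine ⟨α, hα, fun P => ?_⟩
  let e : Fin (d ^ 2) ≃ Fin d × Fin d := (finCongr (sq d)).trans finProdFinEquiv.symm
  obtain ⟨l, hl⟩ := h fun k => P (e k).1 (e k).2
  exact ⟨l, fun i j => by simpa using hl (e.symm (i, j))⟩

/-- One form l controls all d² differences z_i - w_j at once. Sorting both tuples by this form gives
a matching, not known beforehand, whose differences are bounded by α⁻¹ times those of the components
of H_l; this is why the Almgren property concerns d² numbers. -/
theorem IsAlmgrenFamily.exists_dist_le (hθ : IsAlmgrenFamily d θ) :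
    ∃ C : ℝ, 0 ≤ C ∧ ∀ s t : UTuple d,
      dist s t ≤ C * dist (almgrenEmbedding θ s) (almgrenEmbedding θ t) := by
  obtain ⟨α, hα, hform⟩ := hθ.exists_form
  refine ⟨1 / √(d : ℝ) * (√(h : ℝ) / α), by positivity, fun s t => ?_⟩
  obtain ⟨z, rfl⟩ := s.exists_rep
  obtain ⟨w, rfl⟩ := t.exists_rep
  obtain ⟨l, hl⟩ := hform fun i j => z i - w j
  have hh : (0 : ℝ) < h := by exact_mod_cast l.pos
  obtain ⟨ρ, hρ⟩ := exists_perm_monotone (θ l) z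
  obtain ⟨π, hπ⟩ := exists_perm_monotone (θ l) w
  rw [← mk_comp z ρ, ← mk_comp w π]
  refine (dist_mk_le _ _).trans ?_
  unfold tupleDist
  rw [mul_assoc]
  refine mul_le_mul_of_nonneg_left ?_ (by positivity)
  rw [mk_comp, mk_comp, dist_eq_norm]
  refine Real.sqrt_le_iff.mpr ⟨by positivity, ?_⟩
  rw [mul_pow, div_pow, Real.sq_sqrt (by positivity), norm_sq_almgrenEmbedding_sub]
  have h1 : ∑ i, α ^ 2 * ‖(z ∘ ρ) i - (w ∘ π) i‖ ^ 2 ≤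
      ∑ k, (almgrenMap (θ l) (UTuple.mk z) k - almgrenMap (θ l) (UTuple.mk w) k) ^ 2 := by
    refine Finset.sum_le_sum fun k _ => ?_
    rw [almgrenMap_mk_of_monotone hρ, almgrenMap_mk_of_monotone hπ, ← Complex.sub_re, ← mul_sub,
      ← mul_pow]
    refine sq_le_sq.mpr ?_
    rw [abs_of_nonneg (by positivity)]
    exact hl (ρ k) (π k)
  have h2 := Finset.single_le_sum (f := fun l => ∑ k, (almgrenMap (θ l) (UTuple.mk z) k -
    almgrenMap (θ l) (UTuple.mk w) k) ^ 2) (fun _ _ => by positivity) (Finset.mem_univ l)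
  rw [← Finset.mul_sum] at h1
  have h3 := h1.trans h2
  rw [← mul_assoc]
  have e : (h : ℝ) / α ^ 2 * (1 / h) = (α ^ 2)⁻¹ := by field_simp
  rw [e, ← div_eq_inv_mul, le_div_iff₀' (by positivity)]
  exact h3

theorem IsAlmgrenFamily.exists_sum_sq_le (hd : 1 ≤ d) (hθ : IsAlmgrenFamily d θ) :
    ∃ C : ℝ, 0 ≤ C ∧ ∀ P : Fin d → ℂ,
      ∑ i, ‖P i‖ ^ 2 ≤ C * (1 / (h : ℝ) * ∑ l, ∑ i, ((θ l * P i).re) ^ 2) := by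
  obtain ⟨α, hα, hform⟩ := hθ.exists_form
  refine ⟨h / α ^ 2, by positivity, fun P => ?_⟩
  -- The d numbers P i are repeated d times to fill the d² places; d ≥ 1 guarantees that each one
  -- occurs.
  obtain ⟨l, hl⟩ := hform fun i _ => P i
  have hh : (0 : ℝ) < h := by exact_mod_cast l.pos
  have h1 : ∑ i, α ^ 2 * ‖P i‖ ^ 2 ≤ ∑ i, ((θ l * P i).re) ^ 2 := by
    refine Finset.sum_le_sum fun i _ => ?_
    rw [← mul_pow]
    refine sq_le_sq.mpr ?_
    rw [abs_of_nonneg (by positivity)]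
    exact hl i ⟨0, hd⟩
  have h2 := Finset.single_le_sum (f := fun l => ∑ i, ((θ l * P i).re) ^ 2)
    (fun _ _ => by positivity) (Finset.mem_univ l)
  rw [← Finset.mul_sum] at h1
  rw [← mul_assoc]
  have e : (h : ℝ) / α ^ 2 * (1 / h) = (α ^ 2)⁻¹ := by field_simp
  rw [e, ← div_eq_inv_mul, le_div_iff₀' (by positivity)]
  exact h1.trans h2

/-- The vector `V` is the differential of the map built from `θ` at `[z]` in direction `L`. -/
def IsCompatibleDeriv (θ : Fin h → ℂ) (z L : Fin d → ℂ)
    (V : EuclideanSpace ℝ (Fin h × Fin d)) : Prop :=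
  ∀ l k i, almgrenMap (θ l) (UTuple.mk z) k = (θ l * z i).re →
    V (l, k) = 1 / √(h : ℝ) * (θ l * L i).re

theorem IsCompatibleDeriv.comp {z L : Fin d → ℂ} {V : EuclideanSpace ℝ (Fin h × Fin d)}
    (hV : IsCompatibleDeriv θ z L V) (τ : Equiv.Perm (Fin d)) :
    IsCompatibleDeriv θ (z ∘ τ) (L ∘ τ) V := fun l k i hk =>
  hV l k (τ i) (by rwa [mk_comp] at hk)

/-- For each l, a permutation sorting w also sorts z, by closeness and the gap condition. Thus the
k-th components of V and V' belong to the same index i, and the norm becomes a sum over i. -/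
theorem IsCompatibleDeriv.norm_sub_sq {z L w M : Fin d → ℂ}
    {V V' : EuclideanSpace ℝ (Fin h × Fin d)} (hV : IsCompatibleDeriv θ z L V)
    (hV' : IsCompatibleDeriv θ w M V') {δ : ℝ}
    (hclose : ∀ l i, |(θ l * z i).re - (θ l * w i).re| ≤ δ)
    (hsep : ∀ l i j, (θ l * z i).re ≠ (θ l * z j).re →
      2 * δ < |(θ l * z i).re - (θ l * z j).re|) :
    ‖V - V'‖ ^ 2 = 1 / h * ∑ l, ∑ i, ((θ l * (L i - M i)).re) ^ 2 := by
  choose ρ hρ using fun l => exists_perm_monotone (θ l) w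
  have hρ' : ∀ l, Monotone fun k => (θ l * z (ρ l k)).re := fun l =>
    monotone_comp_of_close (x := fun i => (θ l * z i).re) (hclose l) (hsep l) (hρ l)
  rw [norm_sq_of_forall_apply_eq (A := fun l k => (θ l * (L (ρ l k) - M (ρ l k))).re)]
  · congr 1
    refine Finset.sum_congr rfl fun l _ => ?_
    exact Equiv.sum_comp (ρ l) fun i => ((θ l * (L i - M i)).re) ^ 2
  · intro l k
    rw [PiLp.sub_apply, hV l k (ρ l k) (almgrenMap_mk_of_monotone (hρ' l) k),
      hV' l k (ρ l k) (almgrenMap_mk_of_monotone (hρ l) k), mul_sub (θ l), Complex.sub_re]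
    ring

theorem IsCompatibleDeriv.norm_sq {z L : Fin d → ℂ} {V : EuclideanSpace ℝ (Fin h × Fin d)}
    (hV : IsCompatibleDeriv θ z L V) :
    ‖V‖ ^ 2 = 1 / h * ∑ l, ∑ i, ((θ l * L i).re) ^ 2 := by
  -- Comparison with the zero differential at the same point, where δ = 0 is allowed.
  have h0 : IsCompatibleDeriv θ z 0 0 := fun l k i _ => by simp
  have := hV.norm_sub_sq h0 (δ := 0) (fun l i => by simp)
    fun l i j hij => by simpa [sub_eq_zero] using hij
  simpa using this

end Embedding

/-! ### Differentiability of a curve and of its Almgren image -/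

section Differentiability

variable {d h : ℕ} {a b : ℝ} {f : Ioo a b → UTuple d} {x₀ : Ioo a b}

theorem exists_gap (x : Fin d → ℝ) :
    ∃ δ : ℝ, 0 < δ ∧ ∀ i j, x i ≠ x j → 2 * δ < |x i - x j| := by
  have h1 : ∀ i j, ∀ᶠ δ : ℝ in 𝓝[>] 0, x i ≠ x j → 2 * δ < |x i - x j| := by
    intro i j
    by_cases hij : x i = x j
    · exact Eventually.of_forall fun δ h => absurd hij h
    · have hpos : 0 < |x i - x j| := abs_pos.mpr (sub_ne_zero.mpr hij)
      have : Tendsto (fun δ : ℝ => 2 * δ) (𝓝[>] 0) (𝓝 0) := by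
        have : Tendsto (fun δ : ℝ => 2 * δ) (𝓝 0) (𝓝 (2 * 0)) := tendsto_id.const_mul 2
        rw [mul_zero] at this
        exact this.mono_left nhdsWithin_le_nhds
      filter_upwards [this.eventually_lt_const hpos] with δ hδ _ using hδ
  have h2 := eventually_all.mpr fun i => eventually_all.mpr (h1 i)
  obtain ⟨δ, hδ, hpos⟩ := (h2.and self_mem_nhdsWithin).exists
  exact ⟨δ, hpos, hδ⟩

theorem exists_ne_of_eventually {P : Ioo a b → Prop} (hP : ∀ᶠ x in 𝓝 x₀, P x) :
    ∃ x : Ioo a b, (x : ℝ) - x₀ ≠ 0 ∧ P x := by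
  have h1 : ∀ᶠ y in 𝓝 (x₀ : ℝ), ∃ x : Ioo a b, (x : ℝ) = y ∧ P x := by
    rw [← isOpen_Ioo.isOpenEmbedding_subtypeVal.map_nhds_eq x₀, eventually_map]
    filter_upwards [hP] with x hx using ⟨x, rfl, hx⟩
  obtain ⟨y, ⟨x, rfl, hx⟩, hne⟩ :=
    ((h1.filter_mono nhdsWithin_le_nhds).and (self_mem_nhdsWithin (s := {(x₀ : ℝ)}ᶜ))).exists
  exact ⟨x, sub_ne_zero.mpr hne, hx⟩

/-- The difference of two sorted components has a constant sign. Where it vanishes it has a local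
extremum, so its derivative is zero. Thus the derivative attached to a point z_i does not depend on
which of several tied positions it occupies. -/
theorem deriv_almgrenMap_eq_of_eq {θ : ℂ} {v : Fin d → ℝ}
    (hv : ∀ k, HasDerivAt (zeroExt fun x => almgrenMap θ (f x) k) (v k) (x₀ : ℝ)) {k k' : Fin d}
    (hkk : almgrenMap θ (f x₀) k = almgrenMap θ (f x₀) k') : v k = v k' := by
  wlog hle : k ≤ k' generalizing k k'
  · exact (this hkk.symm (le_of_not_ge hle)).symm
  have hd := (hv k').sub (hv k)
  have hmin : IsLocalMin ((zeroExt fun x => almgrenMap θ (f x) k') -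
      zeroExt fun x => almgrenMap θ (f x) k) (x₀ : ℝ) := by
    filter_upwards [isOpen_Ioo.mem_nhds x₀.2] with y hy
    rw [Pi.sub_apply, Pi.sub_apply, zeroExt_coe, zeroExt_coe, zeroExt_of_mem _ hy,
      zeroExt_of_mem _ hy, hkk, sub_self, sub_nonneg]
    exact monotone_almgrenMap θ _ hle
  exact (sub_eq_zero.mp (hmin.hasDerivAt_eq_zero hd)).symm

/-- If the Almgren map of a linear form `η` along the curve is differentiable at `x₀`, then the
branches of the curve have derivatives after applying `η`. -/
theorem exists_branch_deriv {z : Fin d → ℂ} (hz : f x₀ = UTuple.mk z) {θ : ℂ} {v : Fin d → ℝ}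
    (hv : ∀ k, HasDerivAt (zeroExt fun x => almgrenMap θ (f x) k) (v k) (x₀ : ℝ)) :
    ∃ A : Fin d → ℝ,
      (∀ k i, almgrenMap θ (UTuple.mk z) k = (θ * z i).re → v k = A i) ∧
      ∃ δ > 0, ∀ ε > 0, ∀ᶠ x in 𝓝 x₀, ∀ w, UTuple.mk w = f x →
        (∀ i, |(θ * z i).re - (θ * w i).re| ≤ δ) →
        ∀ i, |(θ * w i).re - (θ * z i).re - A i * ((x : ℝ) - x₀)| ≤ ε * |(x : ℝ) - x₀| := by
  obtain ⟨ρ, hρ⟩ := exists_perm_monotone θ z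
  have hρz := almgrenMap_mk_of_monotone hρ
  have hA : ∀ k i, almgrenMap θ (UTuple.mk z) k = (θ * z i).re → v k = v (ρ.symm i) := by
    intro k i hk
    refine deriv_almgrenMap_eq_of_eq hv ?_
    rw [hz, hk, hρz, Equiv.apply_symm_apply]
  obtain ⟨δ, hδ, hgap⟩ := exists_gap fun i => (θ * z i).re
  refine ⟨fun i => v (ρ.symm i), hA, δ, hδ, fun ε hε => ?_⟩
  have h1 : ∀ k, ∀ᶠ x in 𝓝 x₀, |almgrenMap θ (f x) k - almgrenMap θ (f x₀) k -
      v k * ((x : ℝ) - x₀)| ≤ ε * |(x : ℝ) - x₀| := by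
    intro k
    have := continuous_subtype_val.continuousAt.tendsto.eventually
      ((hasDerivAt_iff_isLittleO.mp (hv k)).def hε)
    filter_upwards [this] with x hx
    simpa [mul_comm] using hx
  filter_upwards [eventually_all.mpr h1] with x hx w hw hclose i
  obtain ⟨π, hπ⟩ := exists_perm_monotone θ w
  -- The order π sorting w also sorts z, so w_i and z_i occupy a common position in the two sorted
  -- arrays, and the expansion of that component applies.
  have hπz : Monotone fun k => (θ * z (π k)).re :=
    monotone_comp_of_close (x := fun i => (θ * z i).re) hclose hgap hπ
  have h2 := hx (π.symm i)
  have h3 : almgrenMap θ (UTuple.mk z) (π.symm i) = (θ * z i).re := by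
    rw [almgrenMap_mk_of_monotone hπz, Equiv.apply_symm_apply]
  rw [← hw, hz, h3, almgrenMap_mk_of_monotone hπ, Equiv.apply_symm_apply, hA _ i h3] at h2
  exact h2

theorem hasDerivAt_almgrenMap {θ : Fin h → ℂ} {V : EuclideanSpace ℝ (Fin h × Fin d)}
    (hV : HasDerivAt (zeroExt fun x => almgrenEmbedding θ (f x)) V (x₀ : ℝ)) (l : Fin h)
    (k : Fin d) :
    HasDerivAt (zeroExt fun x => almgrenMap (θ l) (f x) k) (√(h : ℝ) * V (l, k)) (x₀ : ℝ) := by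
  have hh : √(h : ℝ) ≠ 0 := by
    have : (0 : ℝ) < h := by exact_mod_cast l.pos
    positivity
  have h1 := ((EuclideanSpace.proj (𝕜 := ℝ) (l, k)).hasFDerivAt.comp_hasDerivAt (x₀ : ℝ)
    hV).const_mul √(h : ℝ)
  refine h1.congr_of_eventuallyEq (zeroExt_eventuallyEq _ _ (fun x => ?_) x₀)
  simp only [Function.comp_apply, zeroExt_coe]
  change almgrenMap (θ l) (f x) k = √(h : ℝ) * (1 / √(h : ℝ) * almgrenMap (θ l) (f x) k)
  field_simp

theorem abs_re_sub_le {θ : ℂ} (hθ : ‖θ‖ = 1) (z w : ℂ) :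
    |(θ * z).re - (θ * w).re| ≤ ‖z - w‖ := by
  rw [← Complex.sub_re, ← mul_sub]
  refine (Complex.abs_re_le_norm _).trans_eq ?_
  rw [norm_mul, hθ, one_mul]

theorem tendsto_coe_sub : Tendsto (fun x : Ioo a b => |(x : ℝ) - x₀|) (𝓝 x₀) (𝓝 0) := by
  have : Continuous fun x : Ioo a b => |(x : ℝ) - x₀| := by fun_prop
  simpa using this.tendsto x₀

theorem HasDDerivAt.isCompatibleDeriv {θ : Fin h → ℂ} (hθ : ∀ l, ‖θ l‖ = 1) {z L : Fin d → ℂ}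
    (hf : HasDDerivAt f x₀ z L) {V : EuclideanSpace ℝ (Fin h × Fin d)}
    (hV : HasDerivAt (zeroExt fun x => almgrenEmbedding θ (f x)) V (x₀ : ℝ)) :
    IsCompatibleDeriv θ z L V := by
  intro l k i hki
  obtain ⟨A, hA, δ, hδ, hbr⟩ := exists_branch_deriv hf.1 (hasDerivAt_almgrenMap hV l)
  have hh : √(h : ℝ) ≠ 0 := by
    have : (0 : ℝ) < h := by exact_mod_cast l.pos
    positivity
  have key : A i = (θ l * L i).re := by
    refine eq_of_forall_dist_le fun ε hε => ?_
    have hε2 : 0 < ε / 2 := by positivity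
    have h1 := (hf.2.2.const_mul_left √(d : ℝ)).def hε2
    have h2 : ∀ᶠ x : Ioo a b in 𝓝 x₀, ∀ j, (‖L j‖ + ε / 2) * |(x : ℝ) - x₀| < δ :=
      eventually_all.mpr fun j => by
        have := (tendsto_coe_sub (x₀ := x₀)).const_mul (‖L j‖ + ε / 2)
        rw [mul_zero] at this
        exact this.eventually_lt_const hδ
    obtain ⟨x, hne, ⟨h1, h2⟩, h3⟩ := exists_ne_of_eventually ((h1.and h2).and (hbr _ hε2))
    -- The representative of f(x) closest to the affine approximation follows it up to ε/2 · |x -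
    -- x₀|; comparing with the expansion of the sorted components and dividing by |x - x₀|
    -- identifies A i.
    obtain ⟨w, hw, hdist⟩ := exists_rep_tupleDist_eq
      (fun i => z i + L i * (((x : ℝ) - (x₀ : ℝ) : ℝ) : ℂ)) (f x)
    rw [dist_comm, ← hdist, Real.norm_of_nonneg (mul_nonneg (Real.sqrt_nonneg _)
      (tupleDist_nonneg _ _)), Real.norm_eq_abs] at h1
    have h4 : ∀ j, ‖z j + L j * (((x : ℝ) - (x₀ : ℝ) : ℝ) : ℂ) - w j‖ ≤
      ε / 2 * |(x : ℝ) - x₀| := fun j => (norm_sub_le_tupleDist _ w j).trans h1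
    have h5 : ∀ j, |(θ l * z j).re - (θ l * w j).re| ≤ δ := fun j => by
      refine (abs_re_sub_le (hθ l) _ _).trans (le_trans ?_ (h2 j).le)
      calc ‖z j - w j‖ = ‖(z j + L j * (((x : ℝ) - (x₀ : ℝ) : ℝ) : ℂ) - w j) -
              L j * (((x : ℝ) - (x₀ : ℝ) : ℝ) : ℂ)‖ := by congr 1; ring
        _ ≤ ε / 2 * |(x : ℝ) - x₀| + ‖L j‖ * |(x : ℝ) - x₀| := by
            refine (norm_sub_le _ _).trans (add_le_add (h4 j) ?_)
            rw [norm_mul, Complex.norm_real, Real.norm_eq_abs]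
        _ = _ := by ring
    have h6 := h3 w hw h5 i
    have h7 := (abs_re_sub_le (hθ l) _ _).trans (h4 i)
    rw [mul_add, Complex.add_re, ← mul_assoc, Complex.re_mul_ofReal] at h7
    have hpos : 0 < |(x : ℝ) - x₀| := abs_pos.mpr hne
    have h8 : |(A i - (θ l * L i).re) * ((x : ℝ) - x₀)| ≤ ε * |(x : ℝ) - x₀| := by
      rw [abs_le] at h6 h7 ⊢
      constructor <;> linarith [h6.1, h6.2, h7.1, h7.2]
    rw [abs_mul] at h8
    exact le_of_mul_le_mul_right h8 hpos
  rw [← key, ← hA k i hki]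
  field_simp

/-- The number D is the determinant, up to sign, of the two real forms on ℂ = ℝ²; both claims are
Cramer's rule. -/
theorem exists_complex_coordinates {θ₁ θ₂ : ℂ}
    (hne : (θ₂ * (Complex.I * (starRingEnd ℂ) θ₁)).re ≠ 0) :
    (∀ r₁ r₂ : ℝ, ∃ p : ℂ, (θ₁ * p).re = r₁ ∧ (θ₂ * p).re = r₂) ∧
      ∃ K : ℝ, 0 < K ∧ ∀ p : ℂ, ‖p‖ ≤ K * (|(θ₁ * p).re| + |(θ₂ * p).re|) := by
  set D := (θ₂ * (Complex.I * (starRingEnd ℂ) θ₁)).re with hD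
  have hD' : D = θ₂.re * θ₁.im - θ₂.im * θ₁.re := by
    rw [hD]; simp [Complex.mul_re, Complex.mul_im]
  refine ⟨fun r₁ r₂ => ⟨⟨(θ₁.im * r₂ - θ₂.im * r₁) / D, (θ₁.re * r₂ - θ₂.re * r₁) / D⟩, ?_, ?_⟩, ?_⟩
  · simp only [Complex.mul_re]
    field_simp
    rw [hD']; ring
  · simp only [Complex.mul_re]
    field_simp
    rw [hD']; ring
  · set m := |θ₁.re| + |θ₁.im| + |θ₂.re| + |θ₂.im| with hm
    have hm0 : 0 ≤ m := by positivity
    refine ⟨2 * (m + 1) / |D|, by positivity, fun p => ?_⟩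
    set r₁ := (θ₁ * p).re with hr1
    set r₂ := (θ₂ * p).re with hr2
    have e1 : D * p.re = θ₁.im * r₂ - θ₂.im * r₁ := by
      rw [hD', hr1, hr2, Complex.mul_re, Complex.mul_re]; ring
    have e2 : D * p.im = θ₁.re * r₂ - θ₂.re * r₁ := by
      rw [hD', hr1, hr2, Complex.mul_re, Complex.mul_re]; ring
    have bound : ∀ s t : ℝ, |s| ≤ m → |t| ≤ m → |s * r₂ - t * r₁| ≤ m * (|r₁| + |r₂|) := by
      intro s t hs ht
      refine (abs_sub _ _).trans ?_
      rw [abs_mul, abs_mul]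
      have := mul_le_mul_of_nonneg_right hs (abs_nonneg r₂)
      have := mul_le_mul_of_nonneg_right ht (abs_nonneg r₁)
      linarith
    have n1 := abs_nonneg θ₁.re
    have n2 := abs_nonneg θ₁.im
    have n3 := abs_nonneg θ₂.re
    have n4 := abs_nonneg θ₂.im
    have b1 := bound θ₁.im θ₂.im (by linarith) (by linarith)
    have b2 := bound θ₁.re θ₂.re (by linarith) (by linarith)
    rw [← e1, abs_mul] at b1
    rw [← e2, abs_mul] at b2
    rw [div_mul_eq_mul_div, le_div_iff₀ (abs_pos.mpr hne)]
    have h1 := mul_le_mul_of_nonneg_right (Complex.norm_le_abs_re_add_abs_im p) (abs_nonneg D)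
    have := abs_nonneg r₁
    have := abs_nonneg r₂
    nlinarith

theorem exists_almgrenMap_eq (θ : ℂ) (z : Fin d → ℂ) (i : Fin d) :
    ∃ k, almgrenMap θ (UTuple.mk z) k = (θ * z i).re := by
  obtain ⟨ρ, hρ⟩ := exists_perm_monotone θ z
  exact ⟨ρ.symm i, by rw [almgrenMap_mk_of_monotone hρ, Equiv.apply_symm_apply]⟩

/-- A curve is differentiable wherever its composition with an Almgren embedding is. -/
theorem IsAlmgrenFamily.exists_hasDDerivAt (hd : 1 ≤ d) {θ : Fin h → ℂ} (hθ : IsAlmgrenFamily d θ)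
    (hf : Continuous f) {V : EuclideanSpace ℝ (Fin h × Fin d)}
    (hV : HasDerivAt (zeroExt fun x => almgrenEmbedding θ (f x)) V (x₀ : ℝ)) :
    ∃ z L, HasDDerivAt f x₀ z L := by
  obtain ⟨α, hα, hform⟩ := hθ.exists_form
  obtain ⟨l₁, -⟩ := hform fun _ _ => 0
  -- The number i · conj θ₁ spans the kernel of the form l₁, so a form that does not vanish there is
  -- linearly independent of it. Two independent real derivatives determine a complex one.
  obtain ⟨l₂, hl₂⟩ := hform fun _ _ => Complex.I * (starRingEnd ℂ) (θ l₁)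
  have hne : (θ l₂ * (Complex.I * (starRingEnd ℂ) (θ l₁))).re ≠ 0 := by
    have := hl₂ ⟨0, hd⟩ ⟨0, hd⟩
    rw [norm_mul, Complex.norm_I, RCLike.norm_conj, hθ.1 l₁, mul_one, mul_one] at this
    exact abs_pos.mp (hα.trans_le this)
  obtain ⟨hS, K, hK, hbound⟩ := exists_complex_coordinates hne
  choose S hS₁ hS₂ using hS
  obtain ⟨z, hz⟩ := (f x₀).exists_rep
  obtain ⟨A₁, hA₁, δ₁, hδ₁, hbr₁⟩ := exists_branch_deriv hz.symm (hasDerivAt_almgrenMap hV l₁)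
  obtain ⟨A₂, hA₂, δ₂, hδ₂, hbr₂⟩ := exists_branch_deriv hz.symm (hasDerivAt_almgrenMap hV l₂)
  refine ⟨z, fun i => S (A₁ i) (A₂ i), hz.symm, fun i j hij => ?_, ?_⟩
  · obtain ⟨k₁, hk₁⟩ := exists_almgrenMap_eq (θ l₁) z i
    obtain ⟨k₂, hk₂⟩ := exists_almgrenMap_eq (θ l₂) z i
    have e₁ : A₁ i = A₁ j := by rw [← hA₁ k₁ i hk₁, hA₁ k₁ j (by rw [hk₁, hij])]
    have e₂ : A₂ i = A₂ j := by rw [← hA₂ k₂ i hk₂, hA₂ k₂ j (by rw [hk₂, hij])]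
    simp only [e₁, e₂]
  · rw [Asymptotics.isLittleO_iff]
    intro ε hε
    have hε' : 0 < ε / (2 * K) := by positivity
    have hcont : Tendsto (fun x => √(d : ℝ) * dist (f x₀) (f x)) (𝓝 x₀) (𝓝 0) := by
      have : Continuous fun x => √(d : ℝ) * dist (f x₀) (f x) :=
        continuous_const.mul (continuous_const.dist hf)
      simpa using this.tendsto x₀
    filter_upwards [hbr₁ _ hε', hbr₂ _ hε', hcont.eventually_lt_const hδ₁,
      hcont.eventually_lt_const hδ₂] with x h₁ h₂ hc₁ hc₂
    -- One representative, the one nearest to z, is used for both forms, so the two real expansions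
    -- concern the same branch w_i.
    obtain ⟨w, hw, hdist⟩ := exists_rep_tupleDist_eq z (f x)
    rw [hz] at hdist
    have hclose : ∀ i, ‖z i - w i‖ ≤ √(d : ℝ) * dist (f x₀) (f x) := fun i => by
      rw [← hdist]; exact norm_sub_le_tupleDist z w i
    have h₁ := h₁ w hw fun i =>
      ((abs_re_sub_le (hθ.1 l₁) _ _).trans (hclose i)).trans hc₁.le
    have h₂ := h₂ w hw fun i =>
      ((abs_re_sub_le (hθ.1 l₂) _ _).trans (hclose i)).trans hc₂.le
    rw [Real.norm_of_nonneg dist_nonneg, Real.norm_eq_abs, ← hw]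
    refine (dist_mk_le _ _).trans (tupleDist_le_of_forall_norm_le (by positivity) fun i => ?_)
    refine (hbound _).trans ?_
    have e : ∀ l, (θ l * (w i - (z i + S (A₁ i) (A₂ i) * (((x : ℝ) - (x₀ : ℝ) : ℝ) : ℂ)))).re =
        (θ l * w i).re - (θ l * z i).re - (θ l * S (A₁ i) (A₂ i)).re * ((x : ℝ) - x₀) := by
      intro l
      rw [mul_sub, mul_add, ← mul_assoc, Complex.sub_re, Complex.add_re, Complex.re_mul_ofReal]
      ring
    rw [e, e, hS₁, hS₂]
    calc _ ≤ K * (ε / (2 * K) * |(x : ℝ) - x₀| + ε / (2 * K) * |(x : ℝ) - x₀|) := by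
          gcongr
          · exact h₁ i
          · exact h₂ i
      _ = ε * |(x : ℝ) - x₀| := by field_simp; ring

end Differentiability

/-! ### Pointwise comparison of differentials away from and on the collision set -/

section Pointwise

variable {d h : ℕ} {a b : ℝ} {θ : Fin h → ℂ}

theorem IsAlmgrenFamily.exists_tupleDist_le (hd : 1 ≤ d) (hθ : IsAlmgrenFamily d θ) :
    ∃ K : ℝ, 0 ≤ K ∧ ∀ (L M : Fin d → ℂ) (r : ℝ), 0 ≤ r →
      r ^ 2 = 1 / h * ∑ l, ∑ i, ((θ l * (L i - M i)).re) ^ 2 → tupleDist L M ≤ K * r := by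
  obtain ⟨C, hC, hle⟩ := hθ.exists_sum_sq_le hd
  refine ⟨1 / √(d : ℝ) * √C, by positivity, fun L M r hr hr2 => ?_⟩
  unfold tupleDist
  rw [mul_assoc]
  refine mul_le_mul_of_nonneg_left ?_ (by positivity)
  rw [← Real.sqrt_sq hr, ← Real.sqrt_mul hC, hr2]
  exact Real.sqrt_le_sqrt (hle fun i => L i - M i)

theorem le_sqrt_mul_tupleDist (hθ : ∀ l, ‖θ l‖ = 1) {L M : Fin d → ℂ} {r : ℝ}
    (hr2 : r ^ 2 = 1 / h * ∑ l, ∑ i, ((θ l * (L i - M i)).re) ^ 2) :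
    r ≤ √(d : ℝ) * tupleDist L M := by
  rw [sqrt_mul_tupleDist]
  refine Real.le_sqrt_of_sq_le ?_
  rw [hr2]
  exact mean_sum_sq_le hθ fun i => L i - M i

/-- The points `x` where two different components of an Almgren map of `g x` are so close that
they can be interchanged on the way to `f x`. -/
def collisionSet (θ : Fin h → ℂ) (g f : Ioo a b → UTuple d) : Set (Ioo a b) :=
  {x | ∃ l k k', almgrenMap (θ l) (g x) k ≠ almgrenMap (θ l) (g x) k' ∧
    |almgrenMap (θ l) (g x) k - almgrenMap (θ l) (g x) k'| ≤ 2 * (√(d : ℝ) * dist (g x) (f x))}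

variable {f g : Ioo a b → UTuple d} {x : Ioo a b}

/-- An optimal matching moves each point by at most δ = √d · 𝐝(g(x), f(x)), and lying outside the
collision set is precisely the gap condition for this δ. It holds for every optimal τ, so the
maximum in 𝐬₁ costs nothing. -/
theorem norm_sub_sq_of_notMem_collisionSet (hθ : ∀ l, ‖θ l‖ = 1) (hx : x ∉ collisionSet θ g f)
    {z L w M : Fin d → ℂ} {V V' : EuclideanSpace ℝ (Fin h × Fin d)}
    (hz : g x = UTuple.mk z) (hV : IsCompatibleDeriv θ z L V) (hV' : IsCompatibleDeriv θ w M V')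
    {τ : Equiv.Perm (Fin d)} (hτ : tupleDist z (w ∘ τ) = dist (g x) (f x)) :
    ‖V - V'‖ ^ 2 = 1 / h * ∑ l, ∑ i, ((θ l * (L i - (M ∘ τ) i)).re) ^ 2 := by
  refine hV.norm_sub_sq (hV'.comp τ) (δ := √(d : ℝ) * dist (g x) (f x)) (fun l i => ?_)
    fun l i j hij => ?_
  · rw [← hτ]
    exact (abs_re_sub_le (hθ l) _ _).trans (norm_sub_le_tupleDist z (w ∘ τ) i)
  · obtain ⟨k, hk⟩ := exists_almgrenMap_eq (θ l) z i
    obtain ⟨k', hk'⟩ := exists_almgrenMap_eq (θ l) z j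
    by_contra hle
    refine hx ⟨l, k, k', ?_, ?_⟩
    · rwa [hz, hk, hk']
    · rw [hz, hk, hk', ← hz]
      exact not_lt.mp hle

variable {V V' : EuclideanSpace ℝ (Fin h × Fin d)}

theorem derivDist_le_iff {r : ℝ≥0∞} : derivDist g f x ≤ r ↔ ∀ z L, HasDDerivAt g x z L →
    ∀ w M, HasDDerivAt f x w M → ∀ τ : Equiv.Perm (Fin d),
      tupleDist z (w ∘ τ) = dist (g x) (f x) → ENNReal.ofReal (tupleDist L (M ∘ τ)) ≤ r := by
  simp only [derivDist, iSup_le_iff]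

theorem exists_ofReal_tupleDist_le_derivDist {z L w M : Fin d → ℂ} (hz : HasDDerivAt g x z L)
    (hw : HasDDerivAt f x w M) : ∃ τ : Equiv.Perm (Fin d),
      tupleDist z (w ∘ τ) = dist (g x) (f x) ∧
        ENNReal.ofReal (tupleDist L (M ∘ τ)) ≤ derivDist g f x := by
  obtain ⟨τ, hτ⟩ := exists_permDist_eq z w
  have hτ' : tupleDist z (w ∘ τ) = dist (g x) (f x) := by
    rw [← hτ, hz.1, hw.1, dist_mk]
  exact ⟨τ, hτ', derivDist_le_iff.mp le_rfl z L hz w M hw τ hτ'⟩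

/-- Pointwise bound of the distance of the differentials by the differentials of the
compositions with an Almgren embedding. -/
theorem IsAlmgrenFamily.exists_derivDist_le (hd : 1 ≤ d) (hθ : IsAlmgrenFamily d θ) :
    ∃ K : ℝ≥0, ∀ {f g : Ioo a b → UTuple d} {x : Ioo a b}
      {V V' : EuclideanSpace ℝ (Fin h × Fin d)},
      HasDerivAt (zeroExt fun x => almgrenEmbedding θ (g x)) V (x : ℝ) →
      HasDerivAt (zeroExt fun x => almgrenEmbedding θ (f x)) V' (x : ℝ) →
      derivDist g f x ≤ K * ‖V - V'‖ₑ + (2 * K : ℝ≥0) *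
        ‖(collisionSet θ g f).indicator (fun _ => V) x‖ₑ := by
  obtain ⟨K, hK, hle⟩ := hθ.exists_tupleDist_le hd
  refine ⟨K.toNNReal, fun {f g x V V'} hg hf => ?_⟩
  rw [derivDist_le_iff]
  intro z L hz w M hw τ hτ
  have hVz := hz.isCompatibleDeriv hθ.1 hg
  have hVw := hw.isCompatibleDeriv hθ.1 hf
  have hK' : (K.toNNReal : ℝ) = K := Real.coe_toNNReal K hK
  rw [← ofReal_norm, ← ofReal_norm, ← ENNReal.ofReal_coe_nnreal, ← ENNReal.ofReal_coe_nnreal,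
    ← ENNReal.ofReal_mul (by positivity), ← ENNReal.ofReal_mul (by positivity),
    ← ENNReal.ofReal_add (by positivity) (by positivity)]
  refine ENNReal.ofReal_le_ofReal ?_
  push_cast
  rw [hK']
  by_cases hx : x ∈ collisionSet θ g f
  -- No matching of the differentials is available here. The triangle inequality through 0 gives
  -- K(‖V‖ + ‖V'‖), and ‖V'‖ ≤ ‖V‖ + ‖V - V'‖ leaves K‖V - V'‖ + 2K‖V‖, with an error depending on g
  -- alone.
  · rw [indicator_of_mem hx]
    have h1 : tupleDist L 0 ≤ K * ‖V‖ :=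
      hle L 0 ‖V‖ (norm_nonneg _) (by simpa using hVz.norm_sq)
    have h2 : tupleDist (M ∘ τ) 0 ≤ K * ‖V'‖ :=
      hle (M ∘ τ) 0 ‖V'‖ (norm_nonneg _) (by simpa using (hVw.comp τ).norm_sq)
    have h3 := tupleDist_triangle L 0 (M ∘ τ)
    rw [tupleDist_comm 0] at h3
    have h4 : ‖V'‖ ≤ ‖V‖ + ‖V - V'‖ := by
      rw [norm_sub_rev]; exact norm_le_norm_add_norm_sub' V' V
    have h5 := mul_le_mul_of_nonneg_left h4 hK
    linarith
  · rw [indicator_of_notMem hx, norm_zero, mul_zero, add_zero]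
    exact hle _ _ _ (norm_nonneg _) (norm_sub_sq_of_notMem_collisionSet hθ.1 hx hz.1 hVz hVw hτ)

/-- Pointwise bound of the distance of the differentials of the compositions with an Almgren
embedding. -/
theorem IsAlmgrenFamily.exists_enorm_sub_le (hd : 1 ≤ d) (hθ : IsAlmgrenFamily d θ) :
    ∃ K K' : ℝ≥0, ∀ {f g : Ioo a b → UTuple d} {x : Ioo a b}
      {V V' : EuclideanSpace ℝ (Fin h × Fin d)}, Continuous f → Continuous g →
      HasDerivAt (zeroExt fun x => almgrenEmbedding θ (g x)) V (x : ℝ) →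
      HasDerivAt (zeroExt fun x => almgrenEmbedding θ (f x)) V' (x : ℝ) →
      ‖V - V'‖ₑ ≤ K * derivDist g f x + K' *
        ‖(collisionSet θ g f).indicator (fun _ => V) x‖ₑ := by
  obtain ⟨K, hK, hle⟩ := hθ.exists_tupleDist_le hd
  refine ⟨(√(d : ℝ)).toNNReal, (1 + √(d : ℝ) * K).toNNReal, fun {f g x V V'} hfc hgc hg hf => ?_⟩
  -- `derivDist` is zero by convention where a curve is not differentiable, so a lower bound for it
  -- requires the differentials of both curves to exist.
  obtain ⟨z, L, hz⟩ := hθ.exists_hasDDerivAt hd hgc hg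
  obtain ⟨w, M, hw⟩ := hθ.exists_hasDDerivAt hd hfc hf
  have hVz := hz.isCompatibleDeriv hθ.1 hg
  have hVw := hw.isCompatibleDeriv hθ.1 hf
  obtain ⟨τ, hτ, hs⟩ := exists_ofReal_tupleDist_le_derivDist hz hw
  refine le_trans ?_ (add_le_add (mul_le_mul' le_rfl hs) le_rfl)
  have h0 := tupleDist_nonneg L (M ∘ τ)
  rw [← ofReal_norm, ← ofReal_norm, ← ENNReal.ofReal_coe_nnreal, ← ENNReal.ofReal_coe_nnreal,
    ← ENNReal.ofReal_mul (by positivity), ← ENNReal.ofReal_mul (by positivity),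
    ← ENNReal.ofReal_add (by positivity) (by positivity)]
  refine ENNReal.ofReal_le_ofReal ?_
  rw [Real.coe_toNNReal _ (by positivity), Real.coe_toNNReal _ (by positivity)]
  by_cases hx : x ∈ collisionSet θ g f
  -- Here ‖V'‖ is bounded through M and then L: ‖V - V'‖ ≤ ‖V‖ + √d (𝐬₁ + K‖V‖), whence the constant
  -- 1 + √d K.
  · rw [indicator_of_mem hx]
    have h1 : tupleDist L 0 ≤ K * ‖V‖ :=
      hle L 0 ‖V‖ (norm_nonneg _) (by simpa using hVz.norm_sq)
    have h2 : ‖V'‖ ≤ √(d : ℝ) * tupleDist (M ∘ τ) 0 :=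
      le_sqrt_mul_tupleDist hθ.1 (by simpa using (hVw.comp τ).norm_sq)
    have h3 := tupleDist_triangle (M ∘ τ) L 0
    rw [tupleDist_comm _ L] at h3
    have h4 := mul_le_mul_of_nonneg_left (h3.trans (add_le_add le_rfl h1)) (Real.sqrt_nonneg d)
    have h5 := norm_sub_le V V'
    linarith
  · rw [indicator_of_notMem hx, norm_zero, mul_zero, add_zero]
    exact le_sqrt_mul_tupleDist hθ.1
      (norm_sub_sq_of_notMem_collisionSet hθ.1 hx hz.1 hVz hVw hτ)

theorem continuous_almgrenEmbedding (hθ : ∀ l, ‖θ l‖ = 1) :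
    Continuous (almgrenEmbedding θ : UTuple d → _) :=
  (LipschitzWith.of_dist_le_mul (K := (√(d : ℝ)).toNNReal) fun s t => by
    rw [Real.coe_toNNReal _ (Real.sqrt_nonneg _)]
    exact dist_almgrenEmbedding_le hθ s t).continuous

theorem continuous_almgrenMap (hθ : ∀ l, ‖θ l‖ = 1) (l : Fin h) (k : Fin d) :
    Continuous fun s : UTuple d => almgrenMap (θ l) s k := by
  have hh : √(h : ℝ) ≠ 0 := by
    have : (0 : ℝ) < h := by exact_mod_cast l.pos
    positivity
  have h1 : Continuous fun s : UTuple d => √(h : ℝ) * almgrenEmbedding θ s (l, k) :=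
    continuous_const.mul ((EuclideanSpace.proj (𝕜 := ℝ) (l, k)).continuous.comp
      (continuous_almgrenEmbedding hθ))
  convert h1 using 2 with s
  change _ = √(h : ℝ) * (1 / √(h : ℝ) * almgrenMap (θ l) s k)
  field_simp

theorem measurableSet_collisionSet (hθ : ∀ l, ‖θ l‖ = 1) (hg : Continuous g) (hf : Continuous f) :
    MeasurableSet (collisionSet θ g f) := by
  have hc : ∀ l k, Continuous fun x => almgrenMap (θ l) (g x) k := fun l k =>
    (continuous_almgrenMap hθ l k).comp hg
  simp only [collisionSet, ofPred_exists]
  refine MeasurableSet.iUnion fun l => MeasurableSet.iUnion fun k => MeasurableSet.iUnion fun k' => ?_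
  refine MeasurableSet.inter ?_ ?_
  · exact (isClosed_eq (hc l k) (hc l k')).measurableSet.compl
  · exact (isClosed_le ((hc l k).sub (hc l k')).abs
      (continuous_const.mul (continuous_const.mul (hg.dist hf)))).measurableSet

/-- The finitely many nonzero gaps at g(x) are fixed, while the threshold tends to zero. -/
theorem eventually_notMem_collisionSet {F : ℕ → Ioo a b → UTuple d}
    (h : Tendsto (fun n => dist (g x) (F n x)) atTop (𝓝 0)) :
    ∀ᶠ n in atTop, x ∉ collisionSet θ g (F n) := by
  have h2 : Tendsto (fun n => 2 * (√(d : ℝ) * dist (g x) (F n x))) atTop (𝓝 0) := by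
    simpa using (h.const_mul √(d : ℝ)).const_mul 2
  have h3 : ∀ l k k', ∀ᶠ n in atTop,
      ¬(almgrenMap (θ l) (g x) k ≠ almgrenMap (θ l) (g x) k' ∧
        |almgrenMap (θ l) (g x) k - almgrenMap (θ l) (g x) k'| ≤
          2 * (√(d : ℝ) * dist (g x) (F n x))) := by
    intro l k k'
    by_cases he : almgrenMap (θ l) (g x) k = almgrenMap (θ l) (g x) k'
    · exact Eventually.of_forall fun n hn => hn.1 he
    · filter_upwards [h2.eventually_lt_const (abs_pos.mpr (sub_ne_zero.mpr he))] with n hn hn'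
      exact not_le.mpr hn hn'.2
  filter_upwards [eventually_all.mpr fun l => eventually_all.mpr fun k =>
    eventually_all.mpr (h3 l k)] with n hn
  rintro ⟨l, k, k', hmem⟩
  exact hn l k k' hmem

end Pointwise

/-! ### L^q estimates without measurability of 𝐬₁ -/

section Norms

variable {α : Type*} [MeasurableSpace α] {μ : Measure α} {q : ℝ≥0∞}

/-- Measurability is asked only of the dominating functions: s will be `derivDist`, a supremum over
an uncountable family. -/
theorem eLpNorm_le_add_of_enorm_le {X Y : α → ℝ≥0∞} (hq : 1 ≤ q) (hX : AEMeasurable X μ)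
    (hY : AEMeasurable Y μ) {s : α → ℝ≥0∞} (c c' : ℝ≥0) (h : ∀ᵐ x ∂μ, s x ≤ c * X x + c' * Y x) :
    eLpNorm s q μ ≤ c * eLpNorm X q μ + c' * eLpNorm Y q μ := by
  have scale : ∀ (c : ℝ≥0) (X : α → ℝ≥0∞),
      eLpNorm (fun x => c * X x) q μ ≤ c * eLpNorm X q μ := fun c X =>
    eLpNorm_le_nnreal_smul_eLpNorm_of_ae_le_mul' (Eventually.of_forall fun x => by simp) q
  calc eLpNorm s q μ ≤ eLpNorm ((fun x => c * X x) + fun x => c' * Y x) q μ :=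
        eLpNorm_mono_enorm_ae (h.mono fun x hx => by simpa using hx)
    _ ≤ _ := eLpNorm_add_le (hX.const_mul _).aestronglyMeasurable
        (hY.const_mul _).aestronglyMeasurable hq
    _ ≤ _ := add_le_add (scale c X) (scale c' Y)

/-- A version of Minkowski's inequality where one of the summands need not be measurable. -/
theorem eLpNorm_le_add_of_enorm_le' {X Y : α → ℝ≥0∞} (hq : 1 ≤ q) (hX : AEMeasurable X μ)
    (hY : AEMeasurable Y μ) {s : α → ℝ≥0∞} (c c' : ℝ≥0) (h : ∀ᵐ x ∂μ, X x ≤ c * s x + c' * Y x) :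
    eLpNorm X q μ ≤ c * eLpNorm s q μ + c' * eLpNorm Y q μ := by
  -- The truncated difference X - c'Y is measurable and at most c · s, so it takes the place of the
  -- possibly nonmeasurable summand.
  have h1 := eLpNorm_le_add_of_enorm_le (s := X) (X := fun x => X x - c' * Y x) (Y := Y) hq
    (hX.sub (hY.const_mul _)) hY 1 c'
    (Eventually.of_forall fun x => by simpa using le_tsub_add)
  refine h1.trans (add_le_add ?_ le_rfl)
  rw [ENNReal.coe_one, one_mul]
  refine eLpNorm_le_nnreal_smul_eLpNorm_of_ae_le_mul' ?_ q
  filter_upwards [h] with x hx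
  simpa using hx

/-- Absolute continuity of the `L^q` norm. -/
theorem tendsto_eLpNorm_indicator {E : Type*} [NormedAddCommGroup E] (hq : 1 ≤ q) (hqt : q ≠ ∞)
    {V : α → E} (hV : MemLp V q μ) {A : ℕ → Set α} (hA : ∀ n, MeasurableSet (A n))
    (h : ∀ᵐ x ∂μ, ∀ᶠ n in atTop, x ∉ A n) :
    Tendsto (fun n => eLpNorm ((A n).indicator V) q μ) atTop (𝓝 0) := by
  have hq0 : q ≠ 0 := (zero_lt_one.trans_le hq).ne'
  have hqpos : 0 < q.toReal := ENNReal.toReal_pos hq0 hqt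
  simp only [eLpNorm_eq_lintegral_rpow_enorm_toReal hq0 hqt]
  have key : Tendsto (fun n => ∫⁻ x, ‖(A n).indicator V x‖ₑ ^ q.toReal ∂μ) atTop
      (𝓝 (∫⁻ _, 0 ∂μ)) := by
    refine tendsto_lintegral_of_dominated_convergence' (fun x => ‖V x‖ₑ ^ q.toReal)
      (fun n => ((hV.1.indicator (hA n)).enorm.pow_const _)) (fun n => ?_) ?_ ?_
    · exact Eventually.of_forall fun x =>
        ENNReal.rpow_le_rpow (enorm_indicator_le_enorm_self _ _) hqpos.le
    · exact (lintegral_rpow_enorm_lt_top_of_eLpNorm_lt_top hq0 hqt hV.2).ne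
    · filter_upwards [h] with x hx
      refine tendsto_const_nhds.congr' ?_
      filter_upwards [hx] with n hn
      rw [indicator_of_notMem hn, enorm_zero, ENNReal.zero_rpow_of_pos hqpos]
  rw [lintegral_zero] at key
  have := (ENNReal.continuous_rpow_const (y := 1 / q.toReal)).tendsto 0
  rw [ENNReal.zero_rpow_of_pos (by positivity)] at this
  exact this.comp key

end Norms

/-! ### Equivalence of the two convergences and of the topologies -/

section Convergence

variable {d h : ℕ} {a b : ℝ} {q : ℝ≥0∞} {θ : Fin h → ℂ}

/-- The derivative of the composition of a curve with the map built from `θ`. -/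
def almgrenDeriv (θ : Fin h → ℂ) (f : SobolevCurve d a b q) (x : Ioo a b) :
    EuclideanSpace ℝ (Fin h × Fin d) :=
  deriv (zeroExt fun x => almgrenEmbedding θ (f x)) x

theorem continuous_almgrenEmbedding_comp (hθ : ∀ l, ‖θ l‖ = 1) (f : SobolevCurve d a b q) :
    Continuous fun x => almgrenEmbedding θ (f x) :=
  (continuous_almgrenEmbedding hθ).comp f.2.1

theorem exists_dist_almgrenEmbedding_le (hab : a < b) (hq : 1 ≤ q) (hθ : ∀ l, ‖θ l‖ = 1)
    (f : SobolevCurve d a b q) :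
    ∃ φ : Ioo a b → ℝ, MemLp φ q (intervalMeasure a b) ∧ ∀ x y : Ioo a b,
      dist (almgrenEmbedding θ (f x)) (almgrenEmbedding θ (f y)) ≤
        |∫ t in (x : ℝ)..y, zeroExt φ t| := by
  obtain ⟨φ, hφ, hle⟩ := f.2.2.exists_dist_le hab hq f.2.1
  refine ⟨fun x => √(d : ℝ) * φ x, hφ.const_mul _, fun x y => ?_⟩
  have e : (zeroExt fun x => √(d : ℝ) * φ x) = fun t => √(d : ℝ) * zeroExt φ t := by
    ext t
    by_cases ht : t ∈ Ioo a b
    · rw [zeroExt_of_mem _ ht, zeroExt_of_mem _ ht]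
    · rw [zeroExt_of_notMem _ ht, zeroExt_of_notMem _ ht, mul_zero]
  rw [e, intervalIntegral.integral_const_mul, abs_mul, abs_of_nonneg (Real.sqrt_nonneg _)]
  exact (dist_almgrenEmbedding_le hθ _ _).trans
    (mul_le_mul_of_nonneg_left (hle x y) (Real.sqrt_nonneg _))

theorem ae_hasDerivAt_almgrenDeriv (hab : a < b) (hq : 1 ≤ q) (hθ : ∀ l, ‖θ l‖ = 1)
    (f : SobolevCurve d a b q) : ∀ᵐ x ∂intervalMeasure a b,
      HasDerivAt (zeroExt fun x => almgrenEmbedding θ (f x)) (almgrenDeriv θ f x) (x : ℝ) := by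
  obtain ⟨φ, hφ, hle⟩ := exists_dist_almgrenEmbedding_le hab hq hθ f
  exact ae_hasDerivAt_zeroExt (hφ.integrable hq) hle

theorem memLp_almgrenDeriv (hab : a < b) (hq : 1 ≤ q) (hθ : ∀ l, ‖θ l‖ = 1)
    (f : SobolevCurve d a b q) : MemLp (almgrenDeriv θ f) q (intervalMeasure a b) := by
  obtain ⟨φ, hφ, hle⟩ := exists_dist_almgrenEmbedding_le hab hq hθ f
  exact hφ.mono (aestronglyMeasurable_deriv_zeroExt _)
    (ae_norm_deriv_zeroExt_le (hφ.integrable hq) hle)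

theorem isWeakDeriv_almgrenDeriv (hab : a < b) (hq : 1 ≤ q) (hθ : ∀ l, ‖θ l‖ = 1)
    (f : SobolevCurve d a b q) :
    IsWeakDeriv (fun x => almgrenEmbedding θ (f x)) (almgrenDeriv θ f) := by
  obtain ⟨φ, hφ, hle⟩ := exists_dist_almgrenEmbedding_le hab hq hθ f
  exact isWeakDeriv_deriv_zeroExt hab (continuous_almgrenEmbedding_comp hθ f)
    (hφ.integrable hq) hle

theorem isWeakDeriv_almgrenDeriv_sub (hab : a < b) (hq : 1 ≤ q) (hθ : ∀ l, ‖θ l‖ = 1)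
    (f g : SobolevCurve d a b q) :
    IsWeakDeriv (fun x => almgrenEmbedding θ (f x) - almgrenEmbedding θ (g x))
      (almgrenDeriv θ f - almgrenDeriv θ g) := by
  have := (isWeakDeriv_almgrenDeriv hab hq hθ f).add (isWeakDeriv_almgrenDeriv hab hq hθ g).neg
  rw [← sub_eq_add_neg, ← sub_eq_add_neg] at this
  exact this

theorem almgrenDist_eq (hab : a < b) (hq : 1 ≤ q) (hθ : ∀ l, ‖θ l‖ = 1)
    (f g : SobolevCurve d a b q) :
    almgrenDist θ f g =
      eLpNorm (fun x => almgrenEmbedding θ (f x) - almgrenEmbedding θ (g x)) q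
        (intervalMeasure a b) +
      eLpNorm (almgrenDeriv θ g - almgrenDeriv θ f) q (intervalMeasure a b) := by
  rw [eLpNorm_sub_comm (almgrenDeriv θ g)]
  exact sobolevNorm_eq hq (isWeakDeriv_almgrenDeriv_sub hab hq hθ f g)
    ((memLp_almgrenDeriv hab hq hθ f).sub (memLp_almgrenDeriv hab hq hθ g))

theorem enorm_almgrenEmbedding_sub_le (hθ : ∀ l, ‖θ l‖ = 1) (s t : UTuple d) :
    ‖almgrenEmbedding θ s - almgrenEmbedding θ t‖ₑ ≤ ((√(d : ℝ)).toNNReal : ℝ≥0) * ‖dist t s‖ₑ := by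
  rw [← ofReal_norm, ← ofReal_norm, ← ENNReal.ofReal_coe_nnreal,
    ← ENNReal.ofReal_mul (by positivity), Real.coe_toNNReal _ (Real.sqrt_nonneg _),
    Real.norm_of_nonneg dist_nonneg, ← dist_eq_norm, dist_comm t]
  exact ENNReal.ofReal_le_ofReal (dist_almgrenEmbedding_le hθ s t)

/-- The Almgren distance dominates the supremum of the distances. -/
theorem IsAlmgrenFamily.exists_enorm_dist_le (hab : a < b) (hq : 1 ≤ q)
    (hθ : IsAlmgrenFamily d θ) :
    ∃ C : ℝ≥0∞, C ≠ ∞ ∧ ∀ (f g : SobolevCurve d a b q) (x : Ioo a b),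
      ‖dist (g x) (f x)‖ₑ ≤ C * almgrenDist θ f g := by
  obtain ⟨C, hC, hle⟩ := hθ.exists_dist_le
  obtain ⟨C', hC', hle'⟩ := exists_enorm_le_mul_sobolev (Fin h × Fin d) hab hq
  refine ⟨ENNReal.ofReal C * C', ENNReal.mul_ne_top ENNReal.ofReal_ne_top hC', fun f g x => ?_⟩
  have h1 : ‖almgrenEmbedding θ (f x) - almgrenEmbedding θ (g x)‖ₑ ≤ _ := hle' _ _ ((continuous_almgrenEmbedding_comp hθ.1 f).sub
    (continuous_almgrenEmbedding_comp hθ.1 g)) (isWeakDeriv_almgrenDeriv_sub hab hq hθ.1 f g)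
    ((memLp_almgrenDeriv hab hq hθ.1 f).sub (memLp_almgrenDeriv hab hq hθ.1 g)) x
  rw [almgrenDist_eq hab hq hθ.1, eLpNorm_sub_comm (almgrenDeriv θ g), mul_assoc]
  refine le_trans ?_ (mul_le_mul' le_rfl h1)
  rw [← ofReal_norm, ← ofReal_norm, ← ENNReal.ofReal_mul hC, Real.norm_of_nonneg dist_nonneg,
    ← dist_eq_norm, dist_comm (g x)]
  exact ENNReal.ofReal_le_ofReal (hle _ _)

theorem tendsto_eLpNorm_indicator_collisionSet (hab : a < b) (hq : 1 ≤ q) (hqt : q ≠ ∞)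
    (hθ : ∀ l, ‖θ l‖ = 1) {f : ℕ → SobolevCurve d a b q} {g : SobolevCurve d a b q}
    (h : ∀ᵐ x ∂intervalMeasure a b, Tendsto (fun n => ‖dist (g x) (f n x)‖ₑ) atTop (𝓝 0)) :
    Tendsto (fun n => eLpNorm ((collisionSet θ g (f n)).indicator (almgrenDeriv θ g)) q
      (intervalMeasure a b)) atTop (𝓝 0) := by
  refine tendsto_eLpNorm_indicator hq hqt (memLp_almgrenDeriv hab hq hθ g)
    (fun n => measurableSet_collisionSet hθ g.2.1 (f n).2.1) ?_
  filter_upwards [h] with x hx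
  exact eventually_notMem_collisionSet (tendsto_zero_iff_enorm_tendsto_zero.mpr hx)

theorem aemeasurable_enorm_indicator (hab : a < b) (hq : 1 ≤ q) (hθ : ∀ l, ‖θ l‖ = 1)
    (f g : SobolevCurve d a b q) :
    AEMeasurable (fun x => ‖(collisionSet θ g f).indicator (almgrenDeriv θ g) x‖ₑ)
      (intervalMeasure a b) :=
  ((memLp_almgrenDeriv hab hq hθ g).1.indicator
    (measurableSet_collisionSet hθ g.2.1 f.2.1)).enorm

theorem aemeasurable_enorm_almgrenDeriv_sub (hab : a < b) (hq : 1 ≤ q) (hθ : ∀ l, ‖θ l‖ = 1)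
    (f g : SobolevCurve d a b q) :
    AEMeasurable (fun x => ‖almgrenDeriv θ g x - almgrenDeriv θ f x‖ₑ) (intervalMeasure a b) :=
  ((memLp_almgrenDeriv hab hq hθ g).1.sub (memLp_almgrenDeriv hab hq hθ f).1).enorm

theorem indicator_const_apply_self {α β : Type*} [Zero β] (s : Set α) (V : α → β) (x : α) :
    s.indicator (fun _ => V x) x = s.indicator V x := by
  by_cases hx : x ∈ s
  · rw [indicator_of_mem hx, indicator_of_mem hx]
  · rw [indicator_of_notMem hx, indicator_of_notMem hx]

theorem IsAlmgrenFamily.tendsto_intrinsicDist (hd : 1 ≤ d) (hab : a < b) (hq : 1 ≤ q)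
    (hqt : q ≠ ∞) (hθ : IsAlmgrenFamily d θ) {f : ℕ → SobolevCurve d a b q}
    {g : SobolevCurve d a b q} (h : Tendsto (fun n => almgrenDist θ (f n) g) atTop (𝓝 0)) :
    Tendsto (fun n => intrinsicDist g (f n)) atTop (𝓝 0) := by
  obtain ⟨C, hC, hle⟩ := hθ.exists_enorm_dist_le (q := q) hab hq
  have h0 : Tendsto (fun n => C * almgrenDist θ (f n) g) atTop (𝓝 0) := by
    simpa using ENNReal.Tendsto.const_mul h (Or.inr hC)
  have hpt : ∀ x, Tendsto (fun n => ‖dist (g x) (f n x)‖ₑ) atTop (𝓝 0) := fun x =>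
    tendsto_of_tendsto_of_tendsto_of_le_of_le tendsto_const_nhds h0 (fun _ => zero_le)
      fun n => hle (f n) g x
  have h1 : Tendsto (fun n => eLpNorm (fun x => dist (g x) (f n x)) ∞ (intervalMeasure a b)) atTop
      (𝓝 0) := by
    refine tendsto_of_tendsto_of_tendsto_of_le_of_le tendsto_const_nhds h0 (fun _ => zero_le)
      fun n => ?_
    rw [eLpNorm_exponent_top]
    exact eLpNormEssSup_le_of_ae_enorm_bound (Eventually.of_forall fun x => hle (f n) g x)
  have h2 := tendsto_eLpNorm_indicator_collisionSet hab hq hqt hθ.1 (Eventually.of_forall hpt)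
  have h3 : Tendsto (fun n => eLpNorm (almgrenDeriv θ g - almgrenDeriv θ (f n)) q
      (intervalMeasure a b)) atTop (𝓝 0) :=
    tendsto_of_tendsto_of_tendsto_of_le_of_le tendsto_const_nhds h (fun _ => zero_le)
      fun n => by
        rw [almgrenDist_eq hab hq hθ.1]
        exact le_add_self
  obtain ⟨K, hK⟩ := hθ.exists_derivDist_le (a := a) (b := b) hd
  have h4 : Tendsto (fun n => (K : ℝ≥0∞) * eLpNorm (almgrenDeriv θ g - almgrenDeriv θ (f n)) q
      (intervalMeasure a b) + (2 * K : ℝ≥0) * eLpNorm ((collisionSet θ g (f n)).indicator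
        (almgrenDeriv θ g)) q (intervalMeasure a b)) atTop (𝓝 0) := by
    simpa using (ENNReal.Tendsto.const_mul h3 (Or.inr (ENNReal.coe_ne_top (r := K)))).add
      (ENNReal.Tendsto.const_mul h2 (Or.inr (ENNReal.coe_ne_top (r := 2 * K))))
  have h5 : Tendsto (fun n => eLpNorm (derivDist g (f n)) q (intervalMeasure a b)) atTop
      (𝓝 0) := by
    refine tendsto_of_tendsto_of_tendsto_of_le_of_le tendsto_const_nhds h4 (fun _ => zero_le)
      fun n => ?_
    rw [← eLpNorm_enorm (almgrenDeriv θ g - almgrenDeriv θ (f n)),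
      ← eLpNorm_enorm ((collisionSet θ g (f n)).indicator (almgrenDeriv θ g))]
    refine eLpNorm_le_add_of_enorm_le hq (aemeasurable_enorm_almgrenDeriv_sub hab hq hθ.1 _ _)
      (aemeasurable_enorm_indicator hab hq hθ.1 _ _) _ _ ?_
    filter_upwards [ae_hasDerivAt_almgrenDeriv hab hq hθ.1 g,
      ae_hasDerivAt_almgrenDeriv hab hq hθ.1 (f n)] with x hx hx'
    rw [← indicator_const_apply_self]
    exact hK hx hx'
  simpa [intrinsicDist] using h1.add h5

theorem IsAlmgrenFamily.tendsto_almgrenDist (hd : 1 ≤ d) (hab : a < b) (hq : 1 ≤ q)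
    (hqt : q ≠ ∞) (hθ : IsAlmgrenFamily d θ) {f : ℕ → SobolevCurve d a b q}
    {g : SobolevCurve d a b q} (h : Tendsto (fun n => intrinsicDist g (f n)) atTop (𝓝 0)) :
    Tendsto (fun n => almgrenDist θ (f n) g) atTop (𝓝 0) := by
  have h1 : Tendsto (fun n => eLpNorm (fun x => dist (g x) (f n x)) ∞ (intervalMeasure a b)) atTop
      (𝓝 0) :=
    tendsto_of_tendsto_of_tendsto_of_le_of_le tendsto_const_nhds h (fun _ => zero_le)
      fun _ => le_self_add
  have h5 : Tendsto (fun n => eLpNorm (derivDist g (f n)) q (intervalMeasure a b)) atTop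
      (𝓝 0) :=
    tendsto_of_tendsto_of_tendsto_of_le_of_le tendsto_const_nhds h (fun _ => zero_le)
      fun _ => le_add_self
  have hpt : ∀ᵐ x ∂intervalMeasure a b, Tendsto (fun n => ‖dist (g x) (f n x)‖ₑ) atTop (𝓝 0) := by
    have : ∀ n, ∀ᵐ x ∂intervalMeasure a b, ‖dist (g x) (f n x)‖ₑ ≤
        eLpNorm (fun x => dist (g x) (f n x)) ∞ (intervalMeasure a b) := fun n => by
      rw [eLpNorm_exponent_top]
      exact enorm_ae_le_eLpNormEssSup _ _
    filter_upwards [ae_all_iff.mpr this] with x hx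
    exact tendsto_of_tendsto_of_tendsto_of_le_of_le tendsto_const_nhds h1 (fun _ => zero_le) hx
  have h2 := tendsto_eLpNorm_indicator_collisionSet hab hq hqt hθ.1 hpt
  obtain ⟨K, K', hK⟩ := hθ.exists_enorm_sub_le (a := a) (b := b) hd
  have h3 : Tendsto (fun n => eLpNorm (almgrenDeriv θ g - almgrenDeriv θ (f n)) q
      (intervalMeasure a b)) atTop (𝓝 0) := by
    have h4 : Tendsto (fun n => (K : ℝ≥0∞) * eLpNorm (derivDist g (f n)) q
        (intervalMeasure a b) + K' * eLpNorm ((collisionSet θ g (f n)).indicator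
          (almgrenDeriv θ g)) q (intervalMeasure a b)) atTop (𝓝 0) := by
      simpa using (ENNReal.Tendsto.const_mul h5 (Or.inr ENNReal.coe_ne_top)).add
        (ENNReal.Tendsto.const_mul h2 (Or.inr ENNReal.coe_ne_top))
    refine tendsto_of_tendsto_of_tendsto_of_le_of_le tendsto_const_nhds h4 (fun _ => zero_le)
      fun n => ?_
    rw [← eLpNorm_enorm (almgrenDeriv θ g - almgrenDeriv θ (f n)),
      ← eLpNorm_enorm ((collisionSet θ g (f n)).indicator (almgrenDeriv θ g))]
    refine eLpNorm_le_add_of_enorm_le' hq (aemeasurable_enorm_almgrenDeriv_sub hab hq hθ.1 _ _)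
      (aemeasurable_enorm_indicator hab hq hθ.1 _ _) _ _ ?_
    filter_upwards [ae_hasDerivAt_almgrenDeriv hab hq hθ.1 g,
      ae_hasDerivAt_almgrenDeriv hab hq hθ.1 (f n)] with x hx hx'
    rw [← indicator_const_apply_self]
    exact hK (f n).2.1 g.2.1 hx hx'
  have h6 : Tendsto (fun n => eLpNorm (fun x => almgrenEmbedding θ (f n x) -
      almgrenEmbedding θ (g x)) q (intervalMeasure a b)) atTop (𝓝 0) := by
    -- The constant of the inclusion of L^∞ in L^q. Since `(∞ : ℝ≥0∞).toReal` is 0 and 1 / 0 = 0,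
    -- the exponent is 1/q, which is nonnegative, so c is finite.
    set c := intervalMeasure a b univ ^ (1 / q.toReal - 1 / (∞ : ℝ≥0∞).toReal) with hc
    have hct : c ≠ ∞ := by
      refine ENNReal.rpow_ne_top_of_nonneg ?_ (measure_ne_top _ _)
      simp
    have h7 : Tendsto (fun n => ((√(d : ℝ)).toNNReal : ℝ≥0∞) *
        (eLpNorm (fun x => dist (g x) (f n x)) ∞ (intervalMeasure a b) * c)) atTop (𝓝 0) := by
      simpa using ENNReal.Tendsto.const_mul (ENNReal.Tendsto.mul_const h1 (Or.inr hct))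
        (Or.inr ENNReal.coe_ne_top)
    refine tendsto_of_tendsto_of_tendsto_of_le_of_le tendsto_const_nhds h7 (fun _ => zero_le)
      fun n => ?_
    refine (eLpNorm_le_nnreal_smul_eLpNorm_of_ae_le_mul' (g := fun x => dist (g x) (f n x))
      (Eventually.of_forall fun x => enorm_almgrenEmbedding_sub_le hθ.1 _ _) q).trans ?_
    exact mul_le_mul' le_rfl (eLpNorm_le_eLpNorm_mul_rpow_measure_univ le_top
      (g.2.1.dist (f n).2.1).aestronglyMeasurable)
  simp only [almgrenDist_eq hab hq hθ.1]
  simpa using h6.add h3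

/-- Topologies of pseudo-extended metrics are sequential, so continuity of the identity is tested on
sequences, where convergence passes through the θ-free quantity `intrinsicDist`. No triangle
inequality for the latter is needed. -/
theorem almgrenTopology_le {h' : ℕ} {θ' : Fin h' → ℂ} (hd : 1 ≤ d) (hab : a < b) (hq : 1 ≤ q)
    (hqt : q ≠ ∞) (hθ : IsAlmgrenFamily d θ) (hθ' : IsAlmgrenFamily d θ') :
    almgrenTopology d a b hq θ ≤ almgrenTopology d a b hq θ' := by
  rw [← continuous_id_iff_le]
  refine @SeqContinuous.continuous _ _ (almgrenTopology d a b hq θ) (almgrenTopology d a b hq θ')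
    (@FrechetUrysohnSpace.to_sequentialSpace _ (almgrenTopology d a b hq θ)
      (@FirstCountableTopology.frechetUrysohnSpace _ (almgrenTopology d a b hq θ)
        (@UniformSpace.firstCountableTopology _ (almgrenMetric d a b hq θ).toUniformSpace _))) _ ?_
  intro f g hfg
  refine (@tendsto_iff_edist_tendsto_0 _ _ (almgrenMetric d a b hq θ') _ _ _).mpr ?_
  have h1 := (@tendsto_iff_edist_tendsto_0 _ _ (almgrenMetric d a b hq θ) _ _ _).mp hfg
  exact hθ'.tendsto_almgrenDist hd hab hq hqt (hθ.tendsto_intrinsicDist hd hab hq hqt h1)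

end Convergence

end DValued

end

open DValued
theorem theorem4 (d : ℕ) (hd : 1 ≤ d) (a b : ℝ) (hab : a < b) (q : ℝ≥0∞) (hq : 1 ≤ q)
    (hq_top : q ≠ ∞) :
    (∀ (h : ℕ) (θ : Fin h → ℂ), IsAlmgrenFamily d θ →
      ∀ (f : ℕ → SobolevCurve d a b q) (g : SobolevCurve d a b q),
        Tendsto (fun n => intrinsicDist g (f n)) atTop (𝓝 0) ↔
          Tendsto (fun n => almgrenDist θ (f n) g) atTop (𝓝 0)) ∧
    (∀ (h h' : ℕ) (θ : Fin h → ℂ) (θ' : Fin h' → ℂ), IsAlmgrenFamily d θ → IsAlmgrenFamily d θ' →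
      almgrenTopology d a b hq θ = almgrenTopology d a b hq θ') :=
  ⟨fun _ _ hθ _ _ => ⟨hθ.tendsto_almgrenDist hd hab hq hq_top,
      hθ.tendsto_intrinsicDist hd hab hq hq_top⟩,
    fun _ _ _ _ hθ hθ' => le_antisymm (almgrenTopology_le hd hab hq hq_top hθ hθ')
      (almgrenTopology_le hd hab hq hq_top hθ' hθ)⟩
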